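/- Write $\mathrm{lg}\,x=\max\{1,\log x\}$ for $x>0$, and $\mathrm{lg}\,x=1$ for $x \le 0$. **Online Set Cover with cost function $f$.** There are $m$ sets $S_1,\dots,S_m$ with costs $c_1,\dots,c_m\ge 0$ and a function $f:\mathbb R_{\ge0}^m\to\mathbb R_{\ge0}$; these and the number $n$ of elements are known in advance. The $n$ elements arrive one by one; on its arrival an element reveals which of the sets contain it (at least one does). The algorithm maintains a collection of sets; sets may be added but never removed, the collection is empty at the start, and each element must be covered by the collection when it arrives. The cost of a collection is $f(c_1x_1,\dots,c_mx_m)$, where $x\in\{0,1\}^m$ is its indicator vector. A (randomized, integral) online algorithm is $\rho$-competitive if on every input with $n$ elements, fixed independently of the algorithm's random choices, the expected cost of its final collection is at most $\rho\cdot\mathrm{OPT}$, where $\mathrm{OPT}$ is the least cost of a collection that covers all the elements. A monotone, differentiable and convex function $f:\mathbb R_{\ge0}^m\to\mathbb R_{\ge0}$ is *$p$-bounded*, for a real $p\ge1$, if $\nabla f$ is coordinatewise monotone ($x\le y$ implies $\nabla f(x)\le\nabla f(y)$) and $\langle\nabla f(y),y\rangle\le p\,f(y)$ for all $y\in\mathbb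 R_{\ge0}^m$. **Theorem.** There is an absolute constant $C>0$ such that the following hold for all positive integers $m$, $n$, all real $p\ge 1$ and all costs $c_i \ge 0$. 1. For every $p$-bounded $f:\mathbb R_{\ge0}^m\to\mathbb R_{\ge0}$, Online Set Cover with cost function $f$ has a $\bigl(C\,p^2\cdot\mathrm{lg}\,m\cdot\mathrm{lg}\,n\cdot\mathrm{lg}\log n\bigr)^p$-competitive algorithm. 2. For all $d$ and all linear cost functions $L_k(y)=\sum_{i=1}^m b_{ki}y_i$ with $b_{ki}\ge0$ ($k=1,\dots,d$), Online Set Cover with cost function $f(y)=\bigl(\sum_{k=1}^d L_k(y)^p\bigr)^{1/p}$ has a $C\,p\cdot\mathrm{lg}\,m\cdot\mathrm{lg}\,n$-competitive algorithm. -/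

import Mathlib

open MeasureTheory

noncomputable section

namespace OnlineSetCover

/-- An element that arrives is described by the (indices of the) sets that contain it.
An input with `m` sets is the list of the arriving elements, in order of arrival. -/
abbrev Input (m : ℕ) : Type := List (Finset (Fin m))

/-- Every element lies in at least one of the sets. -/
def Input.Feasible {m : ℕ} (I : Input m) : Prop := ∀ s ∈ I, s.Nonempty

/-- The family `A` of sets covers all the elements of the input. -/
def IsCover {m : ℕ} (I : Input m) (A : Finset (Fin m)) : Prop := ∀ s ∈ I, (A ∩ s).Nonempty

/-- The objective `f (c₁ x₁, …, cₘ xₘ)`, where `x` is the indicator vector of `A`. -/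
def cost {m : ℕ} (f : (Fin m → ℝ) → ℝ) (c : Fin m → ℝ) (A : Finset (Fin m)) : ℝ :=
  f (fun i => if i ∈ A then c i else 0)

/-- The offline optimum: the least cost of a cover. -/
def opt {m : ℕ} (f : (Fin m → ℝ) → ℝ) (c : Fin m → ℝ) (I : Input m) : ℝ :=
  sInf (cost f c '' {A | IsCover I A})

/-- A deterministic (integral) online algorithm. `active h` is the family of active sets after the
elements of the list `h` have arrived, so it depends only on the arrivals so far; sets are never
removed, and every element that lies in some set is covered when it arrives. -/
structure DetAlgorithm (m : ℕ) where
  active : Input m → Finset (Fin m)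
  active_nil : active [] = ∅
  active_mono : ∀ (h : Input m) (s : Finset (Fin m)), active h ⊆ active (h ++ [s])
  active_covers : ∀ (h : Input m) (s : Finset (Fin m)), s.Nonempty →
    (active (h ++ [s]) ∩ s).Nonempty

/-- A randomized online algorithm: a random deterministic online algorithm. The input is fixed
independently of the random choices. -/
structure RandAlgorithm (m : ℕ) where
  Ω : Type
  [measurableSpace : MeasurableSpace Ω]
  μ : Measure Ω
  [isProbabilityMeasure : IsProbabilityMeasure μ]
  alg : Ω → DetAlgorithm m
  measurableSet_active : ∀ (h : Input m) (A : Finset (Fin m)),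
    MeasurableSet {ω | (alg ω).active h = A}

/-- The expected cost of the final collection of sets. -/
def RandAlgorithm.expectedCost {m : ℕ} (R : RandAlgorithm m) (f : (Fin m → ℝ) → ℝ)
    (c : Fin m → ℝ) (I : Input m) : ℝ :=
  @integral R.Ω ℝ _ _ R.measurableSpace R.μ (fun ω => cost f c ((R.alg ω).active I))

/-- `R` is `ratio`-competitive on the inputs with `n` elements. -/
def RandAlgorithm.IsCompetitive {m : ℕ} (R : RandAlgorithm m) (n : ℕ) (f : (Fin m → ℝ) → ℝ)
    (c : Fin m → ℝ) (ratio : ℝ) : Prop :=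
  ∀ I : Input m, I.length = n → I.Feasible → R.expectedCost f c I ≤ ratio * opt f c I

/-- The gradient of a function on the nonnegative orthant (one-sided at the boundary). -/
def orthantGradient {m : ℕ} (f : (Fin m → ℝ) → ℝ) (y : Fin m → ℝ) : Fin m → ℝ :=
  fun i => fderivWithin ℝ f (Set.Ici 0) y (Pi.single i 1)

/-- `p`-bounded functions `f : ℝ≥0^m → ℝ≥0` (the values of `f` off the orthant are irrelevant). -/
structure IsPBounded {m : ℕ} (p : ℝ) (f : (Fin m → ℝ) → ℝ) : Prop where
  one_le : 1 ≤ p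
  nonneg : ∀ y, 0 ≤ y → 0 ≤ f y
  monotone : MonotoneOn f (Set.Ici 0)
  differentiable : DifferentiableOn ℝ f (Set.Ici 0)
  convex : ConvexOn ℝ (Set.Ici 0) f
  monotone_gradient : MonotoneOn (orthantGradient f) (Set.Ici 0)
  growth : ∀ y, 0 ≤ y → ∑ i, orthantGradient f y i * y i ≤ p * f y

/-- The `ℓ_p` norm of the vector of the `d` linear functions `y ↦ ∑ i, B k i * y i`. -/
def lpNormOfLinear {d m : ℕ} (p : ℝ) (B : Fin d → Fin m → ℝ) (y : Fin m → ℝ) : ℝ :=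
  (∑ k, |∑ i, B k i * y i| ^ p) ^ (1 / p)

/-- The natural logarithm, truncated from below at `1`, for use in asymptotic bounds. -/
def tlog (x : ℝ) : ℝ := max 1 (Real.log x)

end OnlineSetCover

end

/-! Work with the expected cost `roundedCost` of the random set that contains each `i` independently
with probability `1 - exp (-α * x i)`. An arriving set `s` raises its coordinates multiplicatively,
at speed inverse to the rate at which this expected cost grows with them, until they sum to at least
1. The cost increase is then charged to any single coordinate of `s`, as rate times growth of `log
(x i + δ)`.

Compare with a cover `O`, charging each arrival to a member of `O` that covers it. Marginal costs
increase with the set, so rates only grow over time. They may be replaced by final rates, and the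
logarithms telescope (`roundedCost_fractionalSol_sub_le`). The bound is self-referential: final
rates are expected marginals `F (A + O) - F A` of the random set `A`. Convexity and the scaling
bound `t ^ p` (`HasPowerGrowth.add_le`) turn them into a small multiple of the rounded cost, which
is absorbed on the left, plus a power of the ratio times the cost of `O`
(`HasPowerGrowth.roundedCost_fractionalSol_le`).

Uniform thresholds realise the rounding online. An arrival stays uncovered with probability at most
`exp (-α)` and is then repaired by a cheapest set, which costs no more than `O`. In general `k`
repairs may cost `k ^ p` times as much, so `α = p * tlog n` is taken; for the norm, subadditivity
makes `α = tlog n` enough. The second claim applies the fractional bound to the `p`-th power of the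
norm and takes the root by Jensen. The first bound is obtained without the `lg log n` factor. -/

namespace OnlineSetCover

/-! ### Cost functions with power growth -/

/-- The properties of a cost function on the nonnegative orthant that the rounding algorithm uses:
increments grow with the base point, and scaling by `t ≥ 1` costs at most a factor `t ^ p`. -/
structure HasPowerGrowth {m : ℕ} (p : ℝ) (F : (Fin m → ℝ) → ℝ) : Prop where
  one_le : 1 ≤ p
  nonneg : ∀ y, 0 ≤ y → 0 ≤ F y
  monotone : ∀ y z, 0 ≤ y → y ≤ z → F y ≤ F z
  increment_le : ∀ y z v, 0 ≤ y → y ≤ z → 0 ≤ v → F (y + v) - F y ≤ F (z + v) - F z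
  convex : ConvexOn ℝ (Set.Ici 0) F
  scale_le : ∀ (y : Fin m → ℝ) (t : ℝ), 0 ≤ y → 1 ≤ t → F (t • y) ≤ t ^ p * F y

lemma IsPBounded.hasDerivWithinAt_line {m : ℕ} {p : ℝ} {f : (Fin m → ℝ) → ℝ}
    (hf : IsPBounded p f) {y v : Fin m → ℝ} (hy : 0 ≤ y) (hv : 0 ≤ v) {s : ℝ} (hs : 0 ≤ s) :
    HasDerivWithinAt (fun t : ℝ => f (y + t • v)) (∑ i, orthantGradient f (y + s • v) i * v i)
      (Set.Ici 0) s := by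
  have hmem : ∀ t : ℝ, 0 ≤ t → y + t • v ∈ Set.Ici (0 : Fin m → ℝ) :=
    fun t ht => add_nonneg hy (smul_nonneg ht hv)
  have h1 := (hf.differentiable _ (hmem s hs)).hasFDerivWithinAt
  have h2 : HasDerivWithinAt (fun t : ℝ => y + t • v) v (Set.Ici 0) s := by
    simpa using (((hasDerivAt_id s).smul_const v).const_add y).hasDerivWithinAt
  have h3 := h1.comp_hasDerivWithinAt s h2 (fun t ht => hmem t ht)
  have h4 : (fderivWithin ℝ f (Set.Ici 0) (y + s • v)) v
      = ∑ i, orthantGradient f (y + s • v) i * v i := by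
    refine (congrArg (fderivWithin ℝ f (Set.Ici 0) (y + s • v)) (pi_eq_sum_univ' v)).trans ?_
    rw [map_sum]
    refine Finset.sum_congr rfl fun i _ => ?_
    rw [map_smul, smul_eq_mul, mul_comm, orthantGradient]
  rw [h4] at h3
  exact h3

/-- Monotonicity of the gradient makes `f (z + t • v) - f (y + t • v)` nondecreasing in `t`, and the
growth bound makes `f (t • y) * t ^ (-p)` nonincreasing for `t ≥ 1`. -/
lemma IsPBounded.hasPowerGrowth {m : ℕ} {p : ℝ} {f : (Fin m → ℝ) → ℝ} (hf : IsPBounded p f) :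
    HasPowerGrowth p f where
  one_le := hf.one_le
  nonneg := hf.nonneg
  monotone y z hy hyz := hf.monotone hy (hy.trans hyz) hyz
  convex := hf.convex
  increment_le y z v hy hyz hv := by
    have hz : 0 ≤ z := hy.trans hyz
    have hd : ∀ s : ℝ, 0 ≤ s →
        HasDerivWithinAt (fun t : ℝ => f (z + t • v) - f (y + t • v))
          (∑ i, orthantGradient f (z + s • v) i * v i
            - ∑ i, orthantGradient f (y + s • v) i * v i) (Set.Ici 0) s := fun s hs =>
      (hf.hasDerivWithinAt_line hz hv hs).sub (hf.hasDerivWithinAt_line hy hv hs)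
    have hmono := monotoneOn_of_hasDerivWithinAt_nonneg (convex_Ici (0 : ℝ))
      (fun s hs => (hd s hs).continuousWithinAt)
      (fun s hs => (hd s (interior_subset hs)).mono interior_subset)
      (fun s hs => by
        have hs0 : (0 : ℝ) ≤ s := interior_subset hs
        rw [sub_nonneg]
        refine Finset.sum_le_sum fun i _ => mul_le_mul_of_nonneg_right ?_ (hv i)
        have h0 : 0 ≤ s • v := smul_nonneg hs0 hv
        exact hf.monotone_gradient (add_nonneg hy h0) (add_nonneg hz h0)
          (by gcongr) i)
    have := hmono (Set.mem_Ici.2 le_rfl) (Set.mem_Ici.2 zero_le_one) zero_le_one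
    simp only [zero_smul, add_zero, one_smul] at this
    linarith
  scale_le y t hy ht := by
    have hd : ∀ s : ℝ, 1 ≤ s → HasDerivWithinAt (fun t : ℝ => f (0 + t • y) * t ^ (-p))
        ((∑ i, orthantGradient f (0 + s • y) i * y i) * s ^ (-p)
          + f (0 + s • y) * (-p * s ^ (-p - 1))) (Set.Ici 1) s := fun s hs => by
      have h1 := (hf.hasDerivWithinAt_line le_rfl hy (zero_le_one.trans hs)).mono
        (Set.Ici_subset_Ici.2 (zero_le_one (α := ℝ)))
      have h2 := (Real.hasDerivAt_rpow_const (x := s) (p := -p)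
        (Or.inl (by positivity))).hasDerivWithinAt (s := Set.Ici 1)
      exact h1.mul h2
    have hanti := antitoneOn_of_hasDerivWithinAt_nonpos (convex_Ici (1 : ℝ))
      (fun s hs => (hd s hs).continuousWithinAt)
      (fun s hs => (hd s (interior_subset hs)).mono interior_subset)
      (fun s hs => by
        have hs1 : (1 : ℝ) ≤ s := interior_subset hs
        have hs0 : (0 : ℝ) < s := by positivity
        have hg := hf.growth (s • y) (smul_nonneg hs0.le hy)
        have hp : s ^ (-p) = s * s ^ (-p - 1) := by
          rw [Real.rpow_sub_one hs0.ne']; field_simp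
        have hsum : ∑ i, orthantGradient f (s • y) i * (s • y) i
            = s * ∑ i, orthantGradient f (s • y) i * y i := by
          rw [Finset.mul_sum]
          exact Finset.sum_congr rfl fun i _ => by simp; ring
        rw [hsum] at hg
        rw [zero_add, hp]
        have h0 : 0 < s ^ (-p - 1) := Real.rpow_pos_of_pos hs0 _
        nlinarith)
    have := hanti (Set.mem_Ici.2 le_rfl) (Set.mem_Ici.2 ht) ht
    have ht0 : (0 : ℝ) < t := by positivity
    simp only [zero_add, one_smul, Real.one_rpow, mul_one, Real.rpow_neg ht0.le] at this
    rw [← div_eq_mul_inv, div_le_iff₀ (Real.rpow_pos_of_pos ht0 p)] at this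
    linarith

lemma rpow_increment_le {p a b v : ℝ} (hp : 1 ≤ p) (ha : 0 ≤ a) (hab : a ≤ b) (hv : 0 ≤ v) :
    (a + v) ^ p - a ^ p ≤ (b + v) ^ p - b ^ p := by
  have hd : ∀ s ∈ interior (Set.Ici (0 : ℝ)),
      HasDerivWithinAt (fun t : ℝ => (t + v) ^ p - t ^ p)
        (p * (s + v) ^ (p - 1) - p * s ^ (p - 1)) (interior (Set.Ici 0)) s := fun s _ => by
    have h1 := ((Real.hasDerivAt_rpow_const (x := s + v) (p := p) (Or.inr hp)).comp_add_const s v)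
    exact (h1.sub (Real.hasDerivAt_rpow_const (x := s) (p := p) (Or.inr hp))).hasDerivWithinAt
  have hc : ContinuousOn (fun t : ℝ => (t + v) ^ p - t ^ p) (Set.Ici 0) := by
    have h0 : 0 ≤ p := by linarith
    exact (((continuous_id.add continuous_const).rpow_const fun _ => Or.inr h0).sub
      (continuous_id.rpow_const fun _ => Or.inr h0)).continuousOn
  have hmono := monotoneOn_of_hasDerivWithinAt_nonneg (convex_Ici (0 : ℝ)) hc hd
    (fun s hs => by
      have hs0 : (0 : ℝ) ≤ s := interior_subset hs
      rw [sub_nonneg]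
      have : s ^ (p - 1) ≤ (s + v) ^ (p - 1) :=
        Real.rpow_le_rpow hs0 (by linarith) (by linarith)
      gcongr)
  exact hmono ha (ha.trans hab) hab

/-- The norm itself need not have increasing increments, but its `p`-th power does; this is the
function on which the algorithm for the norm runs. -/
lemma hasPowerGrowth_sum_rpow {d m : ℕ} {p : ℝ} (hp : 1 ≤ p) {B : Fin d → Fin m → ℝ}
    (hB : ∀ k i, 0 ≤ B k i) :
    HasPowerGrowth p (fun y : Fin m → ℝ => ∑ k, |∑ i, B k i * y i| ^ p) where
  one_le := hp
  nonneg y _ := Finset.sum_nonneg fun k _ => Real.rpow_nonneg (abs_nonneg _) _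
  monotone y z hy hyz := by
    have hL : ∀ k, 0 ≤ ∑ i, B k i * y i := fun k =>
      Finset.sum_nonneg fun i _ => mul_nonneg (hB k i) (hy i)
    refine Finset.sum_le_sum fun k _ => Real.rpow_le_rpow (abs_nonneg _)
      (abs_le_abs_of_nonneg (hL k) ?_) (by linarith)
    exact Finset.sum_le_sum fun i _ => mul_le_mul_of_nonneg_left (hyz i) (hB k i)
  increment_le y z v hy hyz hv := by
    have hL : ∀ k (w : Fin m → ℝ), 0 ≤ w → 0 ≤ ∑ i, B k i * w i := fun k w hw =>
      Finset.sum_nonneg fun i _ => mul_nonneg (hB k i) (hw i)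
    rw [← Finset.sum_sub_distrib, ← Finset.sum_sub_distrib]
    refine Finset.sum_le_sum fun k _ => ?_
    simp only [Pi.add_apply, mul_add, Finset.sum_add_distrib]
    have hz := hy.trans hyz
    rw [abs_of_nonneg (add_nonneg (hL k y hy) (hL k v hv)), abs_of_nonneg (hL k y hy),
      abs_of_nonneg (add_nonneg (hL k z hz) (hL k v hv)), abs_of_nonneg (hL k z hz)]
    exact rpow_increment_le hp (hL k y hy)
      (Finset.sum_le_sum fun i _ => mul_le_mul_of_nonneg_left (hyz i) (hB k i)) (hL k v hv)
  convex := by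
    refine ⟨convex_Ici 0, fun y hy z hz a b ha hb hab => ?_⟩
    simp only [smul_eq_mul, Finset.mul_sum]
    rw [← Finset.sum_add_distrib]
    refine Finset.sum_le_sum fun k _ => ?_
    have h := (convexOn_rpow hp).2 (Set.mem_Ici.2 (abs_nonneg (∑ i, B k i * y i)))
      (Set.mem_Ici.2 (abs_nonneg (∑ i, B k i * z i))) ha hb hab
    simp only [smul_eq_mul] at h
    refine le_trans (Real.rpow_le_rpow (abs_nonneg _) ?_ (by linarith)) h
    have h2 : ∑ i, B k i * (a • y + b • z) i
        = a * ∑ i, B k i * y i + b * ∑ i, B k i * z i := by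
      rw [Finset.mul_sum, Finset.mul_sum, ← Finset.sum_add_distrib]
      exact Finset.sum_congr rfl fun i _ => by simp; ring
    rw [h2]
    refine (abs_add_le _ _).trans_eq ?_
    rw [abs_mul, abs_mul, abs_of_nonneg ha, abs_of_nonneg hb]
  scale_le y t hy ht := by
    have ht0 : 0 ≤ t := by linarith
    rw [Finset.mul_sum]
    refine Finset.sum_le_sum fun k _ => le_of_eq ?_
    have h2 : ∑ i, B k i * (t • y) i = t * ∑ i, B k i * y i := by
      rw [Finset.mul_sum]
      exact Finset.sum_congr rfl fun i _ => by simp; ring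
    rw [h2, abs_mul, abs_of_nonneg ht0, Real.mul_rpow ht0 (abs_nonneg _)]

/-- Convexity at `y + z = (1 - θ) • (y / (1 - θ)) + θ • (z / θ)`, followed by the scaling bound for
each summand. A small `θ` keeps the coefficient of `F y` near 1. -/
lemma HasPowerGrowth.add_le {m : ℕ} {p : ℝ} {F : (Fin m → ℝ) → ℝ} (hF : HasPowerGrowth p F)
    {y z : Fin m → ℝ} (hy : 0 ≤ y) (hz : 0 ≤ z) {θ : ℝ} (h0 : 0 < θ) (h1 : θ < 1) :
    F (y + z) ≤ (1 - θ) ^ (1 - p) * F y + θ ^ (1 - p) * F z := by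
  have h1' : 0 < 1 - θ := by linarith
  have key : ∀ (r : ℝ) (w : Fin m → ℝ), 0 < r → r ≤ 1 → 0 ≤ w →
      r * F (r⁻¹ • w) ≤ r ^ (1 - p) * F w := fun r w hr hr1 hw => by
    have h := hF.scale_le w r⁻¹ hw ((one_le_inv₀ hr).2 hr1)
    have h2 : r ^ (1 - p) = r * r⁻¹ ^ p := by
      rw [Real.rpow_sub hr, Real.rpow_one, Real.inv_rpow hr.le, div_eq_mul_inv]
    rw [h2, mul_assoc]
    gcongr
  have hc := hF.convex.2 (Set.mem_Ici.2 (smul_nonneg (inv_nonneg.2 h1'.le) hy))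
    (Set.mem_Ici.2 (smul_nonneg (inv_nonneg.2 h0.le) hz)) h1'.le h0.le (by ring)
  rw [smul_inv_smul₀ h1'.ne', smul_inv_smul₀ h0.ne'] at hc
  simp only [smul_eq_mul] at hc
  linarith [key _ y h1' (by linarith) hy, key _ z h0 h1.le hz]

/-! ### Means over independent random sets -/

/-- The mean of `f` over a random set that contains each `i` independently with probability
`q i`. -/
noncomputable def setMean {m : ℕ} (q : Fin m → ℝ) (f : Finset (Fin m) → ℝ) : ℝ :=
  ∑ A, (∏ i, if i ∈ A then q i else 1 - q i) * f A

/-- The marginal value of `i`, given the other members of the set. -/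
def marginal {m : ℕ} (f : Finset (Fin m) → ℝ) (i : Fin m) (A : Finset (Fin m)) : ℝ :=
  f (insert i A) - f (A.erase i)

lemma setWeight_nonneg {m : ℕ} {q : Fin m → ℝ} (h0 : 0 ≤ q) (h1 : q ≤ 1) (A : Finset (Fin m)) :
    0 ≤ ∏ i, (if i ∈ A then q i else 1 - q i) :=
  Finset.prod_nonneg fun i _ => by
    have := h0 i
    have := h1 i
    simp only [Pi.zero_apply, Pi.one_apply] at *
    split_ifs <;> linarith

lemma sum_setWeight {m : ℕ} (q : Fin m → ℝ) :
    ∑ A : Finset (Fin m), ∏ i, (if i ∈ A then q i else 1 - q i) = 1 := by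
  have h := Finset.prod_add q (fun i => 1 - q i) (Finset.univ : Finset (Fin m))
  simp only [add_sub_cancel, Finset.prod_const_one, Finset.powerset_univ] at h
  refine Eq.trans (Finset.sum_congr rfl fun A _ => ?_) h.symm
  rw [Finset.prod_ite]
  congr 1
  · congr 1; ext i; simp
  · congr 1; ext i; simp

lemma setMean_eq_sum_powerset {m : ℕ} (q : Fin m → ℝ) (f : Finset (Fin m) → ℝ) (i : Fin m) :
    setMean q f = ∑ A ∈ (Finset.univ.erase i).powerset,
      (∏ j ∈ Finset.univ.erase i, if j ∈ A then q j else 1 - q j) *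
        ((1 - q i) * f A + q i * f (insert i A)) := by
  have hi : i ∉ (Finset.univ.erase i : Finset (Fin m)) := Finset.notMem_erase _ _
  have hu : (Finset.univ : Finset (Finset (Fin m)))
      = (insert i (Finset.univ.erase i)).powerset := by
    rw [Finset.insert_erase (Finset.mem_univ i), Finset.powerset_univ]
  rw [setMean, hu, Finset.sum_powerset_insert hi, ← Finset.sum_add_distrib]
  refine Finset.sum_congr rfl fun A hA => ?_
  have hiA : i ∉ A := fun h => hi (Finset.mem_powerset.1 hA h)
  rw [← Finset.mul_prod_erase _ _ (Finset.mem_univ i), ← Finset.mul_prod_erase _ _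
    (Finset.mem_univ i), if_neg hiA, if_pos (Finset.mem_insert_self i A)]
  have : ∏ j ∈ Finset.univ.erase i, (if j ∈ insert i A then q j else 1 - q j)
      = ∏ j ∈ Finset.univ.erase i, (if j ∈ A then q j else 1 - q j) :=
    Finset.prod_congr rfl fun j hj => by simp [Finset.ne_of_mem_erase hj]
  rw [this]
  ring

lemma setMean_update {m : ℕ} (q : Fin m → ℝ) (f : Finset (Fin m) → ℝ) (i : Fin m) (t : ℝ) :
    setMean (Function.update q i t) f
      = ∑ A ∈ (Finset.univ.erase i).powerset,
      (∏ j ∈ Finset.univ.erase i, if j ∈ A then q j else 1 - q j) *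
        ((1 - t) * f A + t * f (insert i A)) := by
  rw [setMean_eq_sum_powerset _ f i]
  refine Finset.sum_congr rfl fun A _ => ?_
  rw [Function.update_self]
  congr 1
  exact Finset.prod_congr rfl fun j hj => by
    rw [Function.update_of_ne (Finset.ne_of_mem_erase hj)]

lemma setMean_marginal {m : ℕ} (q : Fin m → ℝ) (f : Finset (Fin m) → ℝ) (i : Fin m) :
    setMean q (marginal f i) = ∑ A ∈ (Finset.univ.erase i).powerset,
      (∏ j ∈ Finset.univ.erase i, if j ∈ A then q j else 1 - q j) * (f (insert i A) - f A) := by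
  rw [setMean_eq_sum_powerset _ _ i]
  refine Finset.sum_congr rfl fun A hA => ?_
  have hiA : i ∉ A := fun h => Finset.notMem_erase _ _ (Finset.mem_powerset.1 hA h)
  rw [marginal, marginal, Finset.erase_eq_of_notMem hiA, Finset.insert_idem,
    Finset.erase_insert hiA]
  ring

/-- The mean is multilinear in `q`: its slope in the coordinate `i` is the mean marginal of `i`,
which does not depend on `q i`. -/
lemma setMean_update_sub {m : ℕ} (q : Fin m → ℝ) (f : Finset (Fin m) → ℝ) (i : Fin m) (t : ℝ) :
    setMean (Function.update q i t) f - setMean q f = (t - q i) * setMean q (marginal f i) := by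
  rw [setMean_update, setMean_eq_sum_powerset q f i, setMean_marginal, ← Finset.sum_sub_distrib,
    Finset.mul_sum]
  exact Finset.sum_congr rfl fun A _ => by ring

lemma setMean_mono_right {m : ℕ} {q : Fin m → ℝ} (h0 : 0 ≤ q) (h1 : q ≤ 1)
    {f g : Finset (Fin m) → ℝ} (h : ∀ A, f A ≤ g A) : setMean q f ≤ setMean q g :=
  Finset.sum_le_sum fun A _ => mul_le_mul_of_nonneg_left (h A) (setWeight_nonneg h0 h1 A)

lemma setMean_nonneg {m : ℕ} {q : Fin m → ℝ} (h0 : 0 ≤ q) (h1 : q ≤ 1)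
    {f : Finset (Fin m) → ℝ} (h : ∀ A, 0 ≤ f A) : 0 ≤ setMean q f :=
  Finset.sum_nonneg fun A _ => mul_nonneg (setWeight_nonneg h0 h1 A) (h A)

lemma setMean_const {m : ℕ} (q : Fin m → ℝ) (a : ℝ) : setMean q (fun _ => a) = a := by
  rw [setMean, ← Finset.sum_mul, sum_setWeight, one_mul]

lemma setMean_add {m : ℕ} (q : Fin m → ℝ) (f g : Finset (Fin m) → ℝ) :
    setMean q (fun A => f A + g A) = setMean q f + setMean q g := by
  simp only [setMean, mul_add, Finset.sum_add_distrib]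

lemma setMean_const_mul {m : ℕ} (q : Fin m → ℝ) (a : ℝ) (f : Finset (Fin m) → ℝ) :
    setMean q (fun A => a * f A) = a * setMean q f := by
  simp only [setMean, Finset.mul_sum]
  exact Finset.sum_congr rfl fun A _ => by ring

lemma sum_setMean {m : ℕ} {ι : Type*} (q : Fin m → ℝ) (O : Finset ι)
    (f : ι → Finset (Fin m) → ℝ) :
    ∑ i ∈ O, setMean q (f i) = setMean q (fun A => ∑ i ∈ O, f i A) := by
  simp only [setMean, Finset.mul_sum]
  exact Finset.sum_comm

lemma marginal_nonneg {m : ℕ} {f : Finset (Fin m) → ℝ} (hf : Monotone f) (i : Fin m)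
    (A : Finset (Fin m)) : 0 ≤ marginal f i A :=
  sub_nonneg.2 (hf ((Finset.erase_subset i A).trans (Finset.subset_insert i A)))

lemma piecewise_mem_unit {m : ℕ} {q r : Fin m → ℝ} (hq0 : 0 ≤ q) (hqr : q ≤ r) (hr1 : r ≤ 1)
    (S : Finset (Fin m)) : 0 ≤ S.piecewise r q ∧ S.piecewise r q ≤ 1 ∧ S.piecewise r q ≤ r :=
  ⟨Finset.le_piecewise_of_le_of_le S (hq0.trans hqr) hq0,
    Finset.piecewise_le_of_le_of_le S hr1 (hqr.trans hr1),
    Finset.piecewise_le_of_le_of_le S le_rfl hqr⟩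

lemma setMean_mono_left {m : ℕ} {q r : Fin m → ℝ} (hq0 : 0 ≤ q) (hqr : q ≤ r) (hr1 : r ≤ 1)
    {f : Finset (Fin m) → ℝ} (hf : Monotone f) : setMean q f ≤ setMean r f := by
  have key : ∀ S : Finset (Fin m), setMean q f ≤ setMean (S.piecewise r q) f := fun S => by
    induction S using Finset.induction_on with
    | empty => simp
    | insert i S hi ih =>
      obtain ⟨h0, h1, -⟩ := piecewise_mem_unit hq0 hqr hr1 S
      have h := setMean_update_sub (S.piecewise r q) f i (r i)
      rw [← Finset.piecewise_insert, Finset.piecewise_eq_of_notMem _ _ _ hi] at h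
      have := mul_nonneg (sub_nonneg.2 (hqr i)) (setMean_nonneg h0 h1 (marginal_nonneg hf i))
      linarith
  simpa using key Finset.univ

/-- Replace the coordinates of `q` by those of `r` one at a time. Each slope met on the way is at
most the slope at `r`, because marginals are monotone. -/
lemma setMean_sub_le {m : ℕ} {q r : Fin m → ℝ} (hq0 : 0 ≤ q) (hqr : q ≤ r) (hr1 : r ≤ 1)
    {f : Finset (Fin m) → ℝ} (hf : ∀ i, Monotone (marginal f i)) :
    setMean r f - setMean q f ≤ ∑ i, (r i - q i) * setMean r (marginal f i) := by
  have key : ∀ S : Finset (Fin m), setMean (S.piecewise r q) f - setMean q f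
      ≤ ∑ i ∈ S, (r i - q i) * setMean r (marginal f i) := fun S => by
    induction S using Finset.induction_on with
    | empty => simp
    | insert i S hi ih =>
      obtain ⟨h0, h1, h2⟩ := piecewise_mem_unit hq0 hqr hr1 S
      have h := setMean_update_sub (S.piecewise r q) f i (r i)
      rw [← Finset.piecewise_insert, Finset.piecewise_eq_of_notMem _ _ _ hi] at h
      rw [Finset.sum_insert hi]
      have := mul_le_mul_of_nonneg_left (setMean_mono_left h0 h2 hr1 (hf i))
        (sub_nonneg.2 (hqr i))
      linarith
  simpa using key Finset.univ

/-! ### The rounded cost and its rates -/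

/-- The probability with which set `i` is bought when its fractional value is `x i`. -/
noncomputable def buyProb {m : ℕ} (α : ℝ) (x : Fin m → ℝ) : Fin m → ℝ :=
  fun i => 1 - Real.exp (-(α * x i))

/-- The expected cost of rounding `x`. -/
noncomputable def roundedCost {m : ℕ} (α : ℝ) (f : Finset (Fin m) → ℝ) (x : Fin m → ℝ) : ℝ :=
  setMean (buyProb α x) f

/-- An upper bound for the rate at which `roundedCost` grows with `x i`. -/
noncomputable def roundedRate {m : ℕ} (α : ℝ) (f : Finset (Fin m) → ℝ) (i : Fin m)
    (x : Fin m → ℝ) : ℝ :=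
  α * setMean (buyProb α x) (marginal f i)

lemma buyProb_nonneg {m : ℕ} {α : ℝ} (hα : 0 ≤ α) {x : Fin m → ℝ} (hx : 0 ≤ x) :
    0 ≤ buyProb α x := fun i => by
  have : Real.exp (-(α * x i)) ≤ 1 := Real.exp_le_one_iff.2 (neg_nonpos.2 (mul_nonneg hα (hx i)))
  simp only [buyProb, Pi.zero_apply]
  linarith

lemma buyProb_le_one {m : ℕ} (α : ℝ) (x : Fin m → ℝ) : buyProb α x ≤ 1 := fun i => by
  have := Real.exp_pos (-(α * x i))
  simp only [buyProb, Pi.one_apply]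
  linarith

lemma buyProb_mono {m : ℕ} {α : ℝ} (hα : 0 ≤ α) {x y : Fin m → ℝ} (hxy : x ≤ y) :
    buyProb α x ≤ buyProb α y := fun i => by
  have : Real.exp (-(α * y i)) ≤ Real.exp (-(α * x i)) :=
    Real.exp_le_exp.2 (neg_le_neg (mul_le_mul_of_nonneg_left (hxy i) hα))
  simp only [buyProb]
  linarith

lemma buyProb_sub_le {m : ℕ} {α : ℝ} (hα : 0 ≤ α) {x y : Fin m → ℝ} (hx : 0 ≤ x) (hxy : x ≤ y)
    (i : Fin m) : buyProb α y i - buyProb α x i ≤ α * (y i - x i) := by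
  have h1 := Real.add_one_le_exp (-(α * (y i - x i)))
  have h2 : Real.exp (-(α * y i)) = Real.exp (-(α * x i)) * Real.exp (-(α * (y i - x i))) := by
    rw [← Real.exp_add]; ring_nf
  have h3 : Real.exp (-(α * x i)) ≤ 1 :=
    Real.exp_le_one_iff.2 (neg_nonpos.2 (mul_nonneg hα (hx i)))
  have h4 : 0 ≤ α * (y i - x i) := mul_nonneg hα (sub_nonneg.2 (hxy i))
  have h5 : 0 < Real.exp (-(α * x i)) := Real.exp_pos _
  simp only [buyProb]
  rw [h2]
  nlinarith

lemma buyProb_update {m : ℕ} (α : ℝ) (x : Fin m → ℝ) (i : Fin m) (t : ℝ) :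
    buyProb α (Function.update x i t)
      = Function.update (buyProb α x) i (1 - Real.exp (-(α * t))) := by
  ext j
  rcases eq_or_ne j i with rfl | h
  · simp [buyProb]
  · simp [buyProb, h]

lemma continuous_setMean_buyProb {m : ℕ} (α : ℝ) (f : Finset (Fin m) → ℝ) :
    Continuous fun x : Fin m → ℝ => setMean (buyProb α x) f := by
  refine continuous_finsetSum _ fun A _ => Continuous.mul ?_ continuous_const
  refine continuous_finsetProd _ fun i _ => ?_
  by_cases h : i ∈ A
  · simp only [h, if_true, buyProb]; fun_prop
  · simp only [h, if_false, buyProb]; fun_prop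

lemma continuous_roundedCost {m : ℕ} (α : ℝ) (f : Finset (Fin m) → ℝ) :
    Continuous (roundedCost α f) := continuous_setMean_buyProb α f

lemma continuous_roundedRate {m : ℕ} (α : ℝ) (f : Finset (Fin m) → ℝ) (i : Fin m) :
    Continuous (roundedRate α f i) :=
  continuous_const.mul (continuous_setMean_buyProb α (marginal f i))

lemma roundedRate_nonneg {m : ℕ} {α : ℝ} (hα : 0 ≤ α) {f : Finset (Fin m) → ℝ}
    (hf : Monotone f) (i : Fin m) {x : Fin m → ℝ} (hx : 0 ≤ x) : 0 ≤ roundedRate α f i x :=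
  mul_nonneg hα (setMean_nonneg (buyProb_nonneg hα hx) (buyProb_le_one α x)
    (marginal_nonneg hf i))

lemma roundedRate_mono {m : ℕ} {α : ℝ} (hα : 0 ≤ α) {f : Finset (Fin m) → ℝ}
    (hf : ∀ i, Monotone (marginal f i)) (i : Fin m) {x y : Fin m → ℝ} (hx : 0 ≤ x)
    (hxy : x ≤ y) : roundedRate α f i x ≤ roundedRate α f i y :=
  mul_le_mul_of_nonneg_left (setMean_mono_left (buyProb_nonneg hα hx) (buyProb_mono hα hxy)
    (buyProb_le_one α y) (hf i)) hα

lemma roundedCost_sub_le {m : ℕ} {α : ℝ} (hα : 0 ≤ α) {f : Finset (Fin m) → ℝ}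
    (hf : Monotone f) (hf' : ∀ i, Monotone (marginal f i)) {x y : Fin m → ℝ} (hx : 0 ≤ x)
    (hxy : x ≤ y) :
    roundedCost α f y - roundedCost α f x ≤ ∑ i, (y i - x i) * roundedRate α f i y := by
  refine (setMean_sub_le (buyProb_nonneg hα hx) (buyProb_mono hα hxy)
    (buyProb_le_one α y) hf').trans (Finset.sum_le_sum fun i _ => ?_)
  have h := mul_le_mul_of_nonneg_right (buyProb_sub_le hα hx hxy i)
    (setMean_nonneg (buyProb_nonneg hα (hx.trans hxy)) (buyProb_le_one α y)
      (marginal_nonneg hf i))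
  rw [roundedRate]
  linarith

/-- The rounded cost is affine in the buying probability of `i`, so a zero slope at one point means
it is constant along that coordinate. -/
lemma roundedCost_update {m : ℕ} {α : ℝ} (hα : α ≠ 0) {f : Finset (Fin m) → ℝ} {i : Fin m}
    {x : Fin m → ℝ} (h : roundedRate α f i x = 0) (t : ℝ) :
    roundedCost α f (Function.update x i t) = roundedCost α f x := by
  have h0 : setMean (buyProb α x) (marginal f i) = 0 := (mul_eq_zero.1 h).resolve_left hα
  have := setMean_update_sub (buyProb α x) f i (1 - Real.exp (-(α * t)))
  rw [h0, mul_zero, ← buyProb_update] at this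
  exact sub_eq_zero.1 this

/-! ### Existence of fractional steps -/

/-- A fractional step: the increase of the rounded cost is charged to the logarithmic growth of
every single coordinate of `s`. -/
structure IsFractionalStep {m : ℕ} (α : ℝ) (f : Finset (Fin m) → ℝ) (δ : ℝ) (s : Finset (Fin m))
    (x y : Fin m → ℝ) : Prop where
  le : x ≤ y
  le_one : y ≤ 1
  gain_le : ∀ i ∈ s, roundedCost α f y - roundedCost α f x
    ≤ 2 * (roundedRate α f i y * Real.log ((y i + δ) / (x i + δ)))

lemma log_ratio_nonneg {a b δ : ℝ} (hδ : 0 < δ) (ha : 0 ≤ a) (hab : a ≤ b) :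
    0 ≤ Real.log ((b + δ) / (a + δ)) :=
  Real.log_nonneg ((one_le_div (by linarith)).2 (by linarith))

lemma IsFractionalStep.refl {m : ℕ} (α : ℝ) (f : Finset (Fin m) → ℝ) (δ : ℝ)
    (s : Finset (Fin m)) {x : Fin m → ℝ} (h1 : x ≤ 1) : IsFractionalStep α f δ s x x where
  le := le_rfl
  le_one := h1
  gain_le i _ := by
    rcases eq_or_ne (x i + δ) 0 with h | h
    · simp [h]
    · simp [div_self h]

/-- If a coordinate of `s` has rate zero at `y`, it can be raised for free. -/
lemma IsFractionalStep.exists_larger_of_rate_eq_zero {m : ℕ} {α : ℝ} (hα : 0 < α)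
    {f : Finset (Fin m) → ℝ} (hf : Monotone f) {δ : ℝ} (hδ : 0 < δ) {s : Finset (Fin m)}
    {x y : Fin m → ℝ} (hx : 0 ≤ x) (h : IsFractionalStep α f δ s x y) {i : Fin m} (hi : i ∈ s)
    (hrate : roundedRate α f i y = 0) (hsum : ∑ j ∈ s, y j < 1) :
    ∃ z, IsFractionalStep α f δ s x z ∧ ∑ j ∈ s, y j < ∑ j ∈ s, z j ∧ ∑ j ∈ s, z j ≤ 1 := by
  have hy : 0 ≤ y := hx.trans h.le
  have hsplit := Finset.add_sum_erase s y hi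
  have hrest : 0 ≤ ∑ j ∈ s.erase i, y j := Finset.sum_nonneg fun j _ => hy j
  set t := y i + (1 - ∑ j ∈ s, y j) with ht
  have hyz : y ≤ Function.update y i t := by
    intro j
    rcases eq_or_ne j i with rfl | hj
    · simp only [Function.update_self]; linarith
    · simp [hj]
  have hz : ∑ j ∈ s, Function.update y i t j = 1 := by
    rw [← Finset.add_sum_erase s _ hi, Function.update_self]
    have : ∑ j ∈ s.erase i, Function.update y i t j = ∑ j ∈ s.erase i, y j :=
      Finset.sum_congr rfl fun j hj => by rw [Function.update_of_ne (Finset.ne_of_mem_erase hj)]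
    rw [this]
    linarith
  refine ⟨Function.update y i t, ⟨h.le.trans hyz, ?_, fun j _ => ?_⟩, by rw [hz]; exact hsum,
    hz.le⟩
  · intro j
    rcases eq_or_ne j i with rfl | hj
    · simp only [Function.update_self, Pi.one_apply]; linarith
    · simpa [hj] using h.le_one j
  · rw [roundedCost_update hα.ne' hrate]
    -- The charge to the zero-rate coordinate `i` shows that the cost has not increased from `x` to
    -- `y`, so the charges to all other coordinates hold trivially.
    have h1 := h.gain_le i hi
    rw [hrate, zero_mul, mul_zero] at h1
    exact h1.trans (mul_nonneg zero_le_two (mul_nonneg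
      (roundedRate_nonneg hα.le hf j (hy.trans hyz))
      (log_ratio_nonneg hδ (hx j) (h.le.trans hyz j))))

/-- If all rates in `s` are positive, a small simultaneous multiplicative increase of the
coordinates in `s` is again a fractional step. -/
lemma IsFractionalStep.exists_larger_of_rate_pos {m : ℕ} {α : ℝ} (hα : 0 < α)
    {f : Finset (Fin m) → ℝ} (hf : Monotone f) (hf' : ∀ i, Monotone (marginal f i)) {δ : ℝ}
    (hδ : 0 < δ) {s : Finset (Fin m)} (hs : s.Nonempty) (hsδ : s.card * δ < 1)
    {x y : Fin m → ℝ} (hx : 0 ≤ x) (h : IsFractionalStep α f δ s x y)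
    (hrate : ∀ i ∈ s, 0 < roundedRate α f i y) (hsum : ∑ j ∈ s, y j < 1) :
    ∃ z, IsFractionalStep α f δ s x z ∧ ∑ j ∈ s, y j < ∑ j ∈ s, z j ∧ ∑ j ∈ s, z j ≤ 1 := by
  have hy : 0 ≤ y := hx.trans h.le
  -- Speed inverse to the rate: at the old rate, rate times `log (z η i + δ)` grows by exactly `η`
  -- for every `i ∈ s`.
  set z : ℝ → Fin m → ℝ := fun η i =>
    if i ∈ s then (y i + δ) * Real.exp (η / roundedRate α f i y) - δ else y i with hzdef
  have hz0 : z 0 = y := by ext i; simp [hzdef]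
  have hzc : Continuous z := by
    refine continuous_pi fun i => ?_
    by_cases hi : i ∈ s
    · simp only [hzdef, hi, if_true]; fun_prop
    · simp only [hzdef, hi, if_false]; fun_prop
  have hsumc : Continuous fun η => ∑ j ∈ s, z η j :=
    continuous_finsetSum _ fun j _ => (continuous_apply j).comp hzc
  have hcostc : Continuous fun η =>
      ∑ i ∈ s, roundedRate α f i (z η) / roundedRate α f i y * (z η i + δ) :=
    continuous_finsetSum _ fun i _ => (((continuous_roundedRate α f i).comp hzc).div_const _).mul
      (((continuous_apply i).comp hzc).add continuous_const)
  -- At `η = 0` this sum is `∑ y i + s.card * δ < 1 + 1`. This is the origin of the factor 2 in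
  -- `IsFractionalStep`; by continuity it survives for small `η > 0`.
  have hcost0 : ∑ i ∈ s, roundedRate α f i (z 0) / roundedRate α f i y * (z 0 i + δ) < 2 := by
    have : ∑ i ∈ s, roundedRate α f i (z 0) / roundedRate α f i y * (z 0 i + δ)
        = ∑ i ∈ s, y i + s.card * δ := by
      rw [← nsmul_eq_mul, ← Finset.sum_const, ← Finset.sum_add_distrib]
      exact Finset.sum_congr rfl fun i hi => by rw [hz0, div_self (hrate i hi).ne', one_mul]
    linarith
  have hev : ∀ᶠ η in nhds (0 : ℝ), (∑ j ∈ s, z η j < 1) ∧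
      ∑ i ∈ s, roundedRate α f i (z η) / roundedRate α f i y * (z η i + δ) < 2 :=
    ((hsumc.tendsto 0).eventually_lt_const (by rw [hz0]; exact hsum)).and
      ((hcostc.tendsto 0).eventually_lt_const hcost0)
  obtain ⟨η, ⟨hη1, hη2⟩, hη⟩ :=
    ((hev.filter_mono nhdsWithin_le_nhds).and (self_mem_nhdsWithin (s := Set.Ioi (0 : ℝ)))).exists
  have hη0 : 0 < η := hη
  have hzi : ∀ i ∈ s, z η i + δ = (y i + δ) * Real.exp (η / roundedRate α f i y) := fun i hi => by
    simp [hzdef, hi]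
  have hyδ : ∀ i, 0 < y i + δ := fun i => add_pos_of_nonneg_of_pos (hy i) hδ
  have hlt : ∀ i ∈ s, y i < z η i := fun i hi => by
    have h1 : 1 < Real.exp (η / roundedRate α f i y) :=
      Real.one_lt_exp_iff.2 (div_pos hη0 (hrate i hi))
    have := mul_lt_mul_of_pos_left h1 (hyδ i)
    rw [← hzi i hi] at this
    linarith
  have hout : ∀ i ∉ s, z η i = y i := fun i hi => by simp [hzdef, hi]
  have hyz : y ≤ z η := fun i => by
    by_cases hi : i ∈ s
    · exact (hlt i hi).le
    · exact (hout i hi).ge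
  have hz : 0 ≤ z η := hy.trans hyz
  refine ⟨z η, ⟨h.le.trans hyz, fun i => ?_, fun i hi => ?_⟩,
    Finset.sum_lt_sum_of_nonempty hs hlt, hη1.le⟩
  · by_cases hi : i ∈ s
    · exact (Finset.single_le_sum (fun j _ => hz j) hi).trans hη1.le
    · rw [hout i hi]; exact h.le_one i
  · have hgain : roundedCost α f (z η) - roundedCost α f y ≤ 2 * η := by
      refine (roundedCost_sub_le hα.le hf hf' hy hyz).trans ?_
      have h1 : ∑ i, (z η i - y i) * roundedRate α f i (z η)
          = ∑ i ∈ s, (z η i - y i) * roundedRate α f i (z η) := by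
        refine (Finset.sum_subset (Finset.subset_univ s) fun j _ hj => ?_).symm
        rw [hout j hj, sub_self, zero_mul]
      have h2 : ∑ i ∈ s, (z η i - y i) * roundedRate α f i (z η)
          ≤ ∑ i ∈ s, η * (roundedRate α f i (z η) / roundedRate α f i y * (z η i + δ)) := by
        refine Finset.sum_le_sum fun j hj => ?_
        have hinv : y j + δ = (z η j + δ) * Real.exp (-(η / roundedRate α f j y)) := by
          rw [hzi j hj, mul_assoc, ← Real.exp_add]; simp
        have hexp := Real.add_one_le_exp (-(η / roundedRate α f j y))
        have hpos : 0 < z η j + δ := add_pos_of_nonneg_of_pos (hz j) hδ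
        -- From `1 - exp (-u) ≤ u`, measured from the upper endpoint so that `z η j + δ` appears.
        have h3 : z η j - y j ≤ (z η j + δ) * (η / roundedRate α f j y) := by
          nlinarith
        refine (mul_le_mul_of_nonneg_right h3 (roundedRate_nonneg hα.le hf j hz)).trans_eq ?_
        ring
      rw [← Finset.mul_sum] at h2
      rw [h1]
      nlinarith
    have hratio : Real.log ((z η i + δ) / (x i + δ))
        = Real.log ((y i + δ) / (x i + δ)) + η / roundedRate α f i y := by
      have hxδ : 0 < x i + δ := add_pos_of_nonneg_of_pos (hx i) hδ
      rw [hzi i hi, mul_div_right_comm, Real.log_mul (div_pos (hyδ i) hxδ).ne'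
        (Real.exp_pos _).ne', Real.log_exp]
    have hmono := roundedRate_mono hα.le hf' i hy hyz
    have hlog := log_ratio_nonneg hδ (hx i) (h.le i)
    have hfrac : 0 ≤ η / roundedRate α f i y := (div_pos hη0 (hrate i hi)).le
    have hlow : roundedRate α f i y * Real.log ((y i + δ) / (x i + δ)) + η
        ≤ roundedRate α f i (z η) * Real.log ((z η i + δ) / (x i + δ)) := by
      rw [hratio]
      calc _ = roundedRate α f i y
            * (Real.log ((y i + δ) / (x i + δ)) + η / roundedRate α f i y) := by
              rw [mul_add, mul_div_cancel₀ _ (hrate i hi).ne']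
        _ ≤ _ := mul_le_mul_of_nonneg_right hmono (add_nonneg hlog hfrac)
    linarith [h.gain_le i hi]

/-- In place of a differential equation, maximise `∑ i ∈ s, y i` over the compact set of steps with
this sum at most 1. A maximiser with sum below 1 could be extended by one of the two preceding
lemmas. -/
lemma exists_isFractionalStep {m : ℕ} {α : ℝ} (hα : 0 < α) {f : Finset (Fin m) → ℝ}
    (hf : Monotone f) (hf' : ∀ i, Monotone (marginal f i)) {δ : ℝ} (hδ : 0 < δ)
    {s : Finset (Fin m)} (hs : s.Nonempty) (hsδ : s.card * δ < 1) {x : Fin m → ℝ}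
    (hx : 0 ≤ x) (hx1 : x ≤ 1) : ∃ y, IsFractionalStep α f δ s x y ∧ 1 ≤ ∑ i ∈ s, y i := by
  rcases le_or_gt 1 (∑ i ∈ s, x i) with h | h
  · exact ⟨x, .refl α f δ s hx1, h⟩
  have hxδ : ∀ i, 0 < x i + δ := fun i => add_pos_of_nonneg_of_pos (hx i) hδ
  let Q : Set (Fin m → ℝ) := {y | IsFractionalStep α f δ s x y ∧ ∑ i ∈ s, y i ≤ 1}
  have hmemQ : ∀ y, y ∈ Q ↔ IsFractionalStep α f δ s x y ∧ ∑ i ∈ s, y i ≤ 1 := fun y => Iff.rfl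
  have hsumc : Continuous fun y : Fin m → ℝ => ∑ i ∈ s, y i :=
    continuous_finsetSum _ fun i _ => continuous_apply i
  have hQ : IsCompact Q := by
    -- Truncating `y i` at 0 changes nothing above `x`, but makes the logarithm continuous
    -- everywhere, so the constraints are closed.
    have hQ' : Q = {y ∈ Set.Icc x 1 | ∑ i ∈ s, y i ≤ 1 ∧
        ∀ i ∈ s, roundedCost α f y - roundedCost α f x
          ≤ 2 * (roundedRate α f i y * Real.log ((max (y i) 0 + δ) / (x i + δ)))} := by
      ext y
      rw [hmemQ]
      have hmax : x ≤ y → ∀ i, max (y i) 0 = y i := fun h i => max_eq_left ((hx i).trans (h i))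
      constructor
      · exact fun h => ⟨⟨h.1.le, h.1.le_one⟩, h.2, fun i hi => by
          rw [hmax h.1.le]; exact h.1.gain_le i hi⟩
      · exact fun h => ⟨⟨h.1.1, h.1.2, fun i hi => by
          have := h.2.2 i hi
          rwa [hmax h.1.1] at this⟩, h.2.1⟩
    have hclosed : IsClosed {y : Fin m → ℝ | ∑ i ∈ s, y i ≤ 1 ∧
        ∀ i ∈ s, roundedCost α f y - roundedCost α f x
          ≤ 2 * (roundedRate α f i y * Real.log ((max (y i) 0 + δ) / (x i + δ)))} := by
      simp only [Set.ofPred_and, Set.ofPred_forall]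
      refine (isClosed_le hsumc continuous_const).inter
        (isClosed_biInter fun i _ => isClosed_le ?_ ?_)
      · exact (continuous_roundedCost α f).sub continuous_const
      · refine continuous_const.mul ((continuous_roundedRate α f i).mul (Continuous.log ?_ ?_))
        · fun_prop
        · exact fun y => (div_pos (add_pos_of_nonneg_of_pos (le_max_right _ _) hδ) (hxδ i)).ne'
    rw [hQ']
    exact isCompact_Icc.inter_right hclosed
  obtain ⟨y, hyQ, hmax⟩ := hQ.exists_isMaxOn ⟨x, (hmemQ x).2 ⟨.refl α f δ s hx1, h.le⟩⟩
    hsumc.continuousOn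
  obtain ⟨hy, -⟩ := (hmemQ y).1 hyQ
  refine ⟨y, hy, not_lt.1 fun hlt => ?_⟩
  have : ∃ z, IsFractionalStep α f δ s x z ∧ ∑ j ∈ s, y j < ∑ j ∈ s, z j ∧ ∑ j ∈ s, z j ≤ 1 := by
    by_cases hzero : ∃ i ∈ s, roundedRate α f i y = 0
    · obtain ⟨i, hi, hr⟩ := hzero
      exact hy.exists_larger_of_rate_eq_zero hα hf hδ hx hi hr hlt
    · push Not at hzero
      exact hy.exists_larger_of_rate_pos hα hf hf' hδ hs hsδ hx (fun i hi => lt_of_le_of_ne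
        (roundedRate_nonneg hα.le hf i (hx.trans hy.le)) (hzero i hi).symm) hlt
  obtain ⟨z, hz, hyz, hz1⟩ := this
  exact absurd (hmax ((hmemQ z).2 ⟨hz, hz1⟩)) (not_le.2 hyz)

lemma one_le_tlog (x : ℝ) : 1 ≤ tlog x := le_max_left _ _

lemma log_add_two_le (m : ℕ) : Real.log (m + 2) ≤ 2 * tlog m := by
  rcases Nat.lt_or_ge m 2 with h | h
  · have h1 : Real.log ((m : ℝ) + 2) ≤ Real.log (2 * 2) := by
      have : (m : ℝ) ≤ 2 := by exact_mod_cast h.le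
      exact Real.log_le_log (by positivity) (by linarith)
    have h2 : Real.log (2 * 2) = Real.log 2 + Real.log 2 :=
      Real.log_mul two_ne_zero two_ne_zero
    linarith [Real.log_two_lt_d9, one_le_tlog m]
  · have hm : (2 : ℝ) ≤ m := by exact_mod_cast h
    have h1 : Real.log ((m : ℝ) + 2) ≤ Real.log (m * m) :=
      Real.log_le_log (by positivity) (by nlinarith)
    rw [Real.log_mul (by positivity) (by positivity)] at h1
    have : Real.log m ≤ tlog m := le_max_right _ _
    linarith

/-! ### The fractional algorithm and the charging argument -/

section Fractional

/-- The offset of the fractional algorithm. -/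
noncomputable def stepOffset (m : ℕ) : ℝ := 1 / (m + 1)

lemma stepOffset_pos (m : ℕ) : 0 < stepOffset m := by unfold stepOffset; positivity

open Classical in
/-- The fractional algorithm's response to the arrival of `s`. -/
noncomputable def fractionalStep {m : ℕ} (α : ℝ) (f : Finset (Fin m) → ℝ) (s : Finset (Fin m))
    (x : Fin m → ℝ) : Fin m → ℝ :=
  if h : ∃ y, IsFractionalStep α f (stepOffset m) s x y ∧ 1 ≤ ∑ i ∈ s, y i then h.choose else x

/-- The fractional solution after the arrivals in `r`, latest arrival first. -/
noncomputable def fractionalSol {m : ℕ} (α : ℝ) (f : Finset (Fin m) → ℝ) :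
    Input m → Fin m → ℝ
  | [] => 0
  | s :: r => fractionalStep α f s (fractionalSol α f r)

variable {m : ℕ} {α : ℝ} {f : Finset (Fin m) → ℝ}

lemma le_fractionalStep (s : Finset (Fin m)) (x : Fin m → ℝ) : x ≤ fractionalStep α f s x := by
  unfold fractionalStep
  split_ifs with h
  · exact h.choose_spec.1.le
  · exact le_rfl

lemma fractionalStep_le_one (s : Finset (Fin m)) {x : Fin m → ℝ} (hx : x ≤ 1) :
    fractionalStep α f s x ≤ 1 := by
  unfold fractionalStep
  split_ifs with h
  · exact h.choose_spec.1.le_one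
  · exact hx

lemma fractionalSol_nonneg (r : Input m) : 0 ≤ fractionalSol α f r := by
  induction r with
  | nil => exact le_rfl
  | cons s r ih => exact ih.trans (le_fractionalStep s _)

lemma fractionalSol_le_one (r : Input m) : fractionalSol α f r ≤ 1 := by
  induction r with
  | nil => exact fun _ => zero_le_one
  | cons s r ih => exact fractionalStep_le_one s ih

lemma fractionalSol_cons (hα : 0 < α) (hf : Monotone f) (hf' : ∀ i, Monotone (marginal f i))
    {s : Finset (Fin m)} (hs : s.Nonempty) (r : Input m) :
    IsFractionalStep α f (stepOffset m) s (fractionalSol α f r) (fractionalSol α f (s :: r)) ∧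
      1 ≤ ∑ i ∈ s, fractionalSol α f (s :: r) i := by
  have hcard : (s.card : ℝ) * stepOffset m < 1 := by
    have : (s.card : ℝ) ≤ m := by exact_mod_cast (Finset.card_le_univ s).trans_eq (by simp)
    rw [stepOffset, mul_one_div, div_lt_one (by positivity)]
    linarith
  have h := exists_isFractionalStep hα hf hf' (stepOffset_pos m) hs hcard
    (fractionalSol_nonneg (α := α) (f := f) r) (fractionalSol_le_one r)
  have heq : fractionalSol α f (s :: r) = h.choose := by
    rw [fractionalSol, fractionalStep, dif_pos h]
  rw [heq]
  exact h.choose_spec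

lemma setMean_zero (f : Finset (Fin m) → ℝ) : setMean 0 f = f ∅ := by
  rw [setMean, Finset.sum_eq_single ∅]
  · simp
  · intro A _ hA
    obtain ⟨i, hi⟩ := Finset.nonempty_iff_ne_empty.2 hA
    rw [Finset.prod_eq_zero (Finset.mem_univ i) (by simp [hi]), zero_mul]
  · simp

lemma roundedCost_zero : roundedCost α f 0 = f ∅ := by
  rw [roundedCost, ← setMean_zero f]
  congr 1
  ext i
  simp [buyProb]

/-- The rounded cost is at most a logarithmically weighted sum of the final rates over any
cover. -/
lemma roundedCost_fractionalSol_sub_le (hα : 0 < α) (hf : Monotone f)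
    (hf' : ∀ i, Monotone (marginal f i)) {O : Finset (Fin m)} (r : Input m)
    (hr : ∀ s ∈ r, (O ∩ s).Nonempty) :
    roundedCost α f (fractionalSol α f r) - f ∅ ≤ 2 * ∑ i ∈ O,
      roundedRate α f i (fractionalSol α f r) *
        Real.log ((fractionalSol α f r i + stepOffset m) / stepOffset m) := by
  have hδ := stepOffset_pos m
  induction r with
  | nil => simp [fractionalSol, roundedCost_zero]
  | cons s r ih =>
    have ih := ih fun t ht => hr t (List.mem_cons_of_mem _ ht)
    obtain ⟨i₀, hi₀⟩ := hr s List.mem_cons_self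
    rw [Finset.mem_inter] at hi₀
    obtain ⟨hstep, -⟩ := fractionalSol_cons hα hf hf' ⟨i₀, hi₀.2⟩ r
    set x := fractionalSol α f r
    set y := fractionalSol α f (s :: r)
    have hx : 0 ≤ x := fractionalSol_nonneg r
    have hy : 0 ≤ y := hx.trans hstep.le
    -- Old charges are re-evaluated at the new, larger rate; the logarithms then add up to one
    -- telescoped logarithm.
    have hterm : ∀ i, roundedRate α f i x * Real.log ((x i + stepOffset m) / stepOffset m)
        + roundedRate α f i y * Real.log ((y i + stepOffset m) / (x i + stepOffset m))
        ≤ roundedRate α f i y * Real.log ((y i + stepOffset m) / stepOffset m) := fun i => by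
      have hxδ : 0 < x i + stepOffset m := add_pos_of_nonneg_of_pos (hx i) hδ
      have hyδ : 0 < y i + stepOffset m := add_pos_of_nonneg_of_pos (hy i) hδ
      have hlog : Real.log ((y i + stepOffset m) / stepOffset m)
          = Real.log ((x i + stepOffset m) / stepOffset m)
            + Real.log ((y i + stepOffset m) / (x i + stepOffset m)) := by
        rw [← Real.log_mul (by positivity) (by positivity)]
        congr 1
        field_simp
      have h0 : 0 ≤ Real.log ((x i + stepOffset m) / stepOffset m) := by
        have := hx i
        simp only [Pi.zero_apply] at this
        exact Real.log_nonneg ((one_le_div hδ).2 (by linarith))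
      rw [hlog, mul_add]
      gcongr
      exact roundedRate_mono hα.le hf' i hx hstep.le
    have hsum := Finset.sum_le_sum fun i (_ : i ∈ O) => hterm i
    rw [Finset.sum_add_distrib] at hsum
    -- The member `i₀` of the cover that covers `s` alone pays for this step.
    have hsingle := Finset.single_le_sum (f := fun i =>
      roundedRate α f i y * Real.log ((y i + stepOffset m) / (x i + stepOffset m)))
      (fun i _ => mul_nonneg (roundedRate_nonneg hα.le hf i hy)
        (log_ratio_nonneg hδ (hx i) (hstep.le i))) hi₀.1
    have hgain := hstep.gain_le i₀ hi₀.2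
    linarith

lemma roundedCost_fractionalSol_le_sum_rate (hα : 0 < α) (hf : Monotone f)
    (hf' : ∀ i, Monotone (marginal f i)) {O : Finset (Fin m)} (r : Input m)
    (hr : ∀ s ∈ r, (O ∩ s).Nonempty) :
    roundedCost α f (fractionalSol α f r) ≤
      f ∅ + 4 * tlog m * ∑ i ∈ O, roundedRate α f i (fractionalSol α f r) := by
  have h := roundedCost_fractionalSol_sub_le hα hf hf' r hr
  have hx : 0 ≤ fractionalSol α f r := fractionalSol_nonneg r
  have hle : ∀ i ∈ O, roundedRate α f i (fractionalSol α f r) *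
      Real.log ((fractionalSol α f r i + stepOffset m) / stepOffset m)
      ≤ 2 * tlog m * roundedRate α f i (fractionalSol α f r) := fun i _ => by
    rw [mul_comm]
    refine mul_le_mul_of_nonneg_right ((Real.log_le_log ?_ ?_).trans (log_add_two_le m))
      (roundedRate_nonneg hα.le hf i hx)
    · exact div_pos (add_pos_of_nonneg_of_pos (hx i) (stepOffset_pos m)) (stepOffset_pos m)
    · rw [div_le_iff₀ (stepOffset_pos m)]
      have h1 : fractionalSol α f r i ≤ 1 := fractionalSol_le_one r i
      -- Coordinates are at most 1, so each logarithm is at most `log ((1 + δ) / δ) = log (m + 2)`.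
      have h2 : ((m : ℝ) + 2) * stepOffset m = 1 + stepOffset m := by
        rw [stepOffset]; field_simp; ring
      linarith
  have := Finset.sum_le_sum hle
  rw [← Finset.mul_sum] at this
  linarith

end Fractional

/-! ### Competitiveness of the rounded cost -/

section Cost

variable {m : ℕ} {p : ℝ} {F : (Fin m → ℝ) → ℝ} {c : Fin m → ℝ}

/-- The vector of the costs of the sets in `A`. -/
def costVec (c : Fin m → ℝ) (A : Finset (Fin m)) : Fin m → ℝ := fun i => if i ∈ A then c i else 0

lemma cost_eq (F : (Fin m → ℝ) → ℝ) (c : Fin m → ℝ) (A : Finset (Fin m)) :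
    cost F c A = F (costVec c A) := rfl

lemma costVec_nonneg (hc : ∀ i, 0 ≤ c i) (A : Finset (Fin m)) : 0 ≤ costVec c A := fun i => by
  by_cases h : i ∈ A <;> simp [costVec, h, hc i]

lemma costVec_mono (hc : ∀ i, 0 ≤ c i) : Monotone (costVec c) := fun A B hAB i => by
  by_cases h : i ∈ A
  · simp [costVec, h, hAB h]
  · by_cases h' : i ∈ B <;> simp [costVec, h, h', hc i]

lemma costVec_insert {A : Finset (Fin m)} {i : Fin m} (hi : i ∉ A) :
    costVec c (insert i A) = costVec c A + costVec c {i} := by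
  ext j
  rcases eq_or_ne j i with rfl | h
  · simp [costVec, hi]
  · simp [costVec, h]

lemma costVec_empty : costVec c ∅ = 0 := by ext i; simp [costVec]

lemma costVec_union_le (hc : ∀ i, 0 ≤ c i) (A B : Finset (Fin m)) :
    costVec c (A ∪ B) ≤ costVec c A + costVec c B := fun i => by
  by_cases h : i ∈ A <;> by_cases h' : i ∈ B <;> simp [costVec, h, h', hc i]

lemma costVec_eq_sum (A : Finset (Fin m)) : costVec c A = ∑ i ∈ A, costVec c {i} := by
  induction A using Finset.induction_on with
  | empty => simp [costVec_empty]
  | insert i A hi ih => rw [costVec_insert hi, Finset.sum_insert hi, ih, add_comm]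

lemma HasPowerGrowth.cost_nonneg (hF : HasPowerGrowth p F) (hc : ∀ i, 0 ≤ c i)
    (A : Finset (Fin m)) : 0 ≤ cost F c A := hF.nonneg _ (costVec_nonneg hc A)

lemma HasPowerGrowth.cost_mono (hF : HasPowerGrowth p F) (hc : ∀ i, 0 ≤ c i) :
    Monotone (cost F c) := fun A _ hAB =>
  hF.monotone _ _ (costVec_nonneg hc A) (costVec_mono hc hAB)

lemma marginal_cost_eq (F : (Fin m → ℝ) → ℝ) (c : Fin m → ℝ) (i : Fin m) (A : Finset (Fin m)) :
    marginal (cost F c) i A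
      = F (costVec c (A.erase i) + costVec c {i}) - F (costVec c (A.erase i)) := by
  have h : insert i (A.erase i) = insert i A := by
    ext j
    by_cases hj : j = i <;> simp [hj]
  rw [marginal, cost_eq, cost_eq, ← costVec_insert (Finset.notMem_erase i A), h]

lemma HasPowerGrowth.marginal_mono (hF : HasPowerGrowth p F) (hc : ∀ i, 0 ≤ c i) (i : Fin m) :
    Monotone (marginal (cost F c) i) := fun A A' hA => by
  rw [marginal_cost_eq, marginal_cost_eq]
  exact hF.increment_le _ _ _ (costVec_nonneg hc _)
    (costVec_mono hc (Finset.erase_subset_erase i hA)) (costVec_nonneg hc _)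

/-- Add the members of `O` one by one on top of `A`. Each increment dominates the marginal, whose
base `A.erase i` is smaller; members of `A` may be counted twice. -/
lemma HasPowerGrowth.sum_marginal_le (hF : HasPowerGrowth p F) (hc : ∀ i, 0 ≤ c i)
    (A O : Finset (Fin m)) :
    ∑ i ∈ O, marginal (cost F c) i A ≤ F (costVec c A + costVec c O) - F (costVec c A) := by
  induction O using Finset.induction_on with
  | empty => simp [costVec_empty]
  | insert i O hi ih =>
    have hA := costVec_nonneg hc A
    have hO := costVec_nonneg hc O
    have h1 := hF.increment_le _ (costVec c A + costVec c O) _ (costVec_nonneg hc (A.erase i))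
      ((costVec_mono hc (Finset.erase_subset i A)).trans (le_add_of_nonneg_right hO))
      (costVec_nonneg hc {i})
    rw [Finset.sum_insert hi, costVec_insert hi, marginal_cost_eq, ← add_assoc]
    linarith

/-- The power is at most `exp (2 * p * θ)`, since `-log (1 - θ) ≤ 2 * θ` for `θ ≤ 1 / 4`; the
exponential is then linearised. -/
lemma one_sub_rpow_le {p θ : ℝ} (hp : 1 ≤ p) (h0 : 0 < θ) (hθ : p * θ ≤ 1 / 4) :
    (1 - θ) ^ (1 - p) ≤ 1 + 4 * (p * θ) := by
  have hθ1 : θ ≤ 1 / 4 := by nlinarith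
  have h1 : 0 < 1 - θ := by linarith
  have hlog : -Real.log (1 - θ) ≤ 2 * θ := by
    have h := Real.log_le_sub_one_of_pos (inv_pos.2 h1)
    rw [Real.log_inv] at h
    have h2 : (1 - θ)⁻¹ ≤ 1 + 2 * θ := by
      rw [inv_le_iff_one_le_mul₀ h1]
      nlinarith
    linarith
  have hexp : (1 - θ) ^ (1 - p) ≤ Real.exp (2 * (p * θ)) := by
    rw [Real.rpow_def_of_pos h1]
    exact Real.exp_le_exp.2 (by nlinarith)
  refine hexp.trans ?_
  have h3 := Real.one_sub_le_exp_neg (2 * (p * θ))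
  have h4 : Real.exp (2 * (p * θ)) * Real.exp (-(2 * (p * θ))) = 1 := by
    rw [← Real.exp_add]; simp
  have h5 := Real.exp_pos (2 * (p * θ))
  have h6 : 0 < p * θ := by positivity
  have h7 : Real.exp (2 * (p * θ)) * (1 - 2 * (p * θ)) ≤ 1 := by nlinarith
  have h8 : 1 ≤ (1 + 4 * (p * θ)) * (1 - 2 * (p * θ)) := by nlinarith
  exact le_of_mul_le_mul_right (h7.trans h8) (by linarith)

/-- The rounded cost of the fractional solution is competitive against every cover. -/
lemma HasPowerGrowth.roundedCost_fractionalSol_le (hF : HasPowerGrowth p F) (hc : ∀ i, 0 ≤ c i)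
    {α : ℝ} (hα : 1 ≤ α) {O : Finset (Fin m)} (r : Input m) (hr : ∀ s ∈ r, (O ∩ s).Nonempty) :
    roundedCost α (cost F c) (fractionalSol α (cost F c) r)
      ≤ 4 * (32 * (p * α * tlog m)) ^ p * cost F c O := by
  have hp := hF.one_le
  have hα0 : 0 < α := by linarith
  have hT := one_le_tlog (m : ℝ)
  have hmono := hF.cost_mono hc
  have hb := roundedCost_fractionalSol_le_sum_rate hα0 hmono (hF.marginal_mono hc) r hr
  set x := fractionalSol α (cost F c) r with hxdef
  have hx : 0 ≤ x := fractionalSol_nonneg r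
  set G := roundedCost α (cost F c) x with hG
  set T := tlog (m : ℝ)
  -- With `θ = N⁻¹`, the coefficient of `G` on the right becomes `4 * T * α * (4 * p / N) = 1 / 2`,
  -- so half of `G` is absorbed on the left.
  set N := 32 * (p * α * T) with hN
  have hpαT : 1 ≤ p * α * T := one_le_mul_of_one_le_of_one_le
    (one_le_mul_of_one_le_of_one_le hp hα) hT
  have hN0 : 0 < N := by positivity
  have hθ0 : 0 < N⁻¹ := inv_pos.2 hN0
  have hNθ : N * N⁻¹ = 1 := mul_inv_cancel₀ hN0.ne'
  have hpθ : p * N⁻¹ ≤ 1 / 4 := by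
    have : 32 * p ≤ N := by
      rw [hN]
      nlinarith [one_le_mul_of_one_le_of_one_le hα hT]
    have : 32 * (p * N⁻¹) ≤ 1 := by nlinarith
    linarith
  have hθ1 : N⁻¹ < 1 := by nlinarith
  -- The marginals are bounded for each realised set `A` separately and averaged afterwards, which
  -- turns `cost F c A` into `G`.
  have hrate : ∑ i ∈ O, roundedRate α (cost F c) i x
      ≤ α * (((1 - N⁻¹) ^ (1 - p) - 1) * G + N⁻¹ ^ (1 - p) * cost F c O) := by
    simp only [roundedRate]
    rw [← Finset.mul_sum, sum_setMean]
    refine mul_le_mul_of_nonneg_left ?_ hα0.le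
    refine (setMean_mono_right (buyProb_nonneg hα0.le hx) (buyProb_le_one α x)
      (g := fun A => ((1 - N⁻¹) ^ (1 - p) - 1) * cost F c A + N⁻¹ ^ (1 - p) * cost F c O)
      fun A => ?_).trans_eq ?_
    · have h1 := hF.sum_marginal_le hc A O
      have h2 := hF.add_le (costVec_nonneg hc A) (costVec_nonneg hc O) hθ0 hθ1
      simp only [cost_eq] at h1 ⊢
      linarith
    · rw [setMean_add, setMean_const_mul, setMean_const, hG, roundedCost]
  have hone := one_sub_rpow_le hp hθ0 hpθ
  have hpow : N⁻¹ ^ (1 - p) = N⁻¹ * N ^ p := by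
    rw [Real.rpow_sub hθ0, Real.rpow_one, Real.inv_rpow hN0.le, div_inv_eq_mul]
  have hG0 : 0 ≤ G := setMean_nonneg (buyProb_nonneg hα0.le hx) (buyProb_le_one α x)
    (hF.cost_nonneg hc)
  have hO := hF.cost_nonneg hc O
  have hempty : cost F c ∅ ≤ cost F c O := hmono (Finset.empty_subset O)
  have hNp : 1 ≤ N ^ p := Real.one_le_rpow (by rw [hN]; linarith) (by linarith)
  have hNO : cost F c O ≤ N ^ p * cost F c O := le_mul_of_one_le_left hO hNp
  rw [hpow] at hrate
  have hαT : 0 ≤ 4 * T * α := by positivity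
  have hmain : 4 * T * ∑ i ∈ O, roundedRate α (cost F c) i x
      ≤ 4 * T * α * (4 * (p * N⁻¹) * G + N⁻¹ * N ^ p * cost F c O) := by
    have h1 : 4 * T * ∑ i ∈ O, roundedRate α (cost F c) i x ≤ 4 * T *
        (α * (((1 - N⁻¹) ^ (1 - p) - 1) * G + N⁻¹ * N ^ p * cost F c O)) :=
      mul_le_mul_of_nonneg_left hrate (by positivity)
    refine h1.trans ?_
    rw [← mul_assoc]
    refine mul_le_mul_of_nonneg_left ?_ hαT
    have := mul_le_mul_of_nonneg_right (by linarith : (1 - N⁻¹) ^ (1 - p) - 1 ≤ 4 * (p * N⁻¹)) hG0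
    linarith
  have hhalf : 4 * T * α * (4 * (p * N⁻¹) * G) = G / 2 := by
    have : 4 * T * α * (4 * (p * N⁻¹) * G) = (N * N⁻¹) * G / 2 := by rw [hN]; ring
    rw [this, hNθ, one_mul]
  have hrest : 4 * T * α * (N⁻¹ * N ^ p * cost F c O) ≤ N ^ p * cost F c O := by
    have h1 : 4 * T * α ≤ N := by
      have : 0 ≤ α * T := by positivity
      rw [hN]; nlinarith
    have h2 : 4 * T * α * N⁻¹ ≤ 1 := by
      rw [← hNθ]; gcongr
    have h3 : 0 ≤ N ^ p * cost F c O := by positivity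
    nlinarith
  rw [mul_add, hhalf] at hmain
  linarith

end Cost

/-! ### Random variables with finitely many values -/

section DiscreteRandom

open Classical in
lemma eq_sum_indicator {Ω ι : Type*} [Fintype ι] (g : Ω → ι) (Φ : ι → ℝ) :
    (fun ω => Φ (g ω)) = fun ω => ∑ a, Set.indicator {ω | g ω = a} (fun _ => Φ a) ω := by
  funext ω
  simp [Set.indicator_apply]

variable {Ω ι : Type*} [MeasurableSpace Ω] {μ : Measure Ω} [IsFiniteMeasure μ] [Fintype ι]

lemma integrable_comp_of_measurableSet_eq {g : Ω → ι} (hg : ∀ a, MeasurableSet {ω | g ω = a})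
    (Φ : ι → ℝ) : Integrable (fun ω => Φ (g ω)) μ := by
  rw [eq_sum_indicator]
  exact integrable_finsetSum _ fun a _ => (integrable_const _).indicator (hg a)

lemma integral_comp_of_measurableSet_eq {g : Ω → ι} (hg : ∀ a, MeasurableSet {ω | g ω = a})
    (Φ : ι → ℝ) : ∫ ω, Φ (g ω) ∂μ = ∑ a, μ.real {ω | g ω = a} * Φ a := by
  rw [eq_sum_indicator, integral_finsetSum _ fun a _ => (integrable_const _).indicator (hg a)]
  refine Finset.sum_congr rfl fun a _ => ?_
  rw [integral_indicator_const _ (hg a), smul_eq_mul]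

lemma measurableSet_eq_comp₂ {κ : Type*} {g h : Ω → ι}
    (hg : ∀ a, MeasurableSet {ω | g ω = a}) (hh : ∀ a, MeasurableSet {ω | h ω = a})
    (u : ι → ι → κ) (b : κ) : MeasurableSet {ω | u (g ω) (h ω) = b} := by
  have : {ω | u (g ω) (h ω) = b}
      = ⋃ a, ⋃ a', ⋃ (_ : u a a' = b), {ω | g ω = a} ∩ {ω | h ω = a'} := by
    ext ω
    simp only [Set.mem_iUnion, Set.mem_inter_iff, Set.mem_ofPred_eq, exists_prop]
    exact ⟨fun h' => ⟨_, _, h', rfl, rfl⟩, fun ⟨_, _, h', h1, h2⟩ => by rw [h1, h2, h']⟩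
  rw [this]
  exact MeasurableSet.iUnion fun a => MeasurableSet.iUnion fun a' => MeasurableSet.iUnion fun _ =>
    (hg a).inter (hh a')

end DiscreteRandom

/-! ### Threshold rounding -/

section Thresholds

variable {m : ℕ}

/-- Independent uniform thresholds in `[0, 1]`. -/
noncomputable def thresholdMeasure (m : ℕ) : Measure (Fin m → ℝ) :=
  Measure.pi fun _ => volume.restrict (Set.Icc 0 1)

instance isProbabilityMeasure_restrict_unit :
    IsProbabilityMeasure ((volume : Measure ℝ).restrict (Set.Icc 0 1)) := ⟨by simp⟩

instance isProbabilityMeasure_thresholdMeasure : IsProbabilityMeasure (thresholdMeasure m) := by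
  unfold thresholdMeasure; infer_instance

open Classical in
/-- The sets whose thresholds lie below `q`. -/
noncomputable def bought (q ω : Fin m → ℝ) : Finset (Fin m) :=
  Finset.univ.filter fun i => ω i ∈ Set.Ico 0 (q i)

lemma mem_bought {q ω : Fin m → ℝ} {i : Fin m} : i ∈ bought q ω ↔ ω i ∈ Set.Ico 0 (q i) := by
  simp [bought]

/-- Thresholds are drawn once for the whole run, so an increasing fractional solution never discards
a set. -/
lemma bought_mono {q r : Fin m → ℝ} (h : q ≤ r) (ω : Fin m → ℝ) : bought q ω ⊆ bought r ω :=
  fun i hi => mem_bought.2 (Set.Ico_subset_Ico_right (h i) (mem_bought.1 hi))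

lemma bought_zero (ω : Fin m → ℝ) : bought 0 ω = ∅ := by
  ext i
  simp [mem_bought]

lemma restrict_unit_real_Ico {t : ℝ} (h0 : 0 ≤ t) (h1 : t ≤ 1) :
    ((volume : Measure ℝ).restrict (Set.Icc 0 1)).real (Set.Ico 0 t) = t := by
  have hsub : Set.Ico 0 t ⊆ Set.Icc 0 1 := fun x hx => ⟨hx.1, hx.2.le.trans h1⟩
  rw [measureReal_restrict_apply measurableSet_Ico, Set.inter_eq_left.2 hsub, Real.volume_real_Ico_of_le h0, sub_zero]

lemma thresholdMeasure_real_pi (S : Fin m → Set ℝ) :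
    (thresholdMeasure m).real (Set.univ.pi S)
      = ∏ i, ((volume : Measure ℝ).restrict (Set.Icc 0 1)).real (S i) := by
  simp only [Measure.real, thresholdMeasure, Measure.pi_pi, ENNReal.toReal_prod]

lemma setOf_bought_eq (q : Fin m → ℝ) (A : Finset (Fin m)) :
    {ω | bought q ω = A}
      = Set.univ.pi fun i => if i ∈ A then Set.Ico 0 (q i) else (Set.Ico 0 (q i))ᶜ := by
  ext ω
  simp only [Set.mem_ofPred_eq, Finset.ext_iff, mem_bought, Set.mem_univ_pi]
  refine forall_congr' fun i => ?_
  by_cases h : i ∈ A <;> simp [h]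

lemma measurableSet_bought_eq (q : Fin m → ℝ) (A : Finset (Fin m)) :
    MeasurableSet {ω | bought q ω = A} := by
  rw [setOf_bought_eq]
  refine MeasurableSet.univ_pi fun i => ?_
  split_ifs
  exacts [measurableSet_Ico, measurableSet_Ico.compl]

lemma integral_bought {q : Fin m → ℝ} (h0 : 0 ≤ q) (h1 : q ≤ 1) (f : Finset (Fin m) → ℝ) :
    ∫ ω, f (bought q ω) ∂(thresholdMeasure m) = setMean q f := by
  rw [integral_comp_of_measurableSet_eq (measurableSet_bought_eq q), setMean]
  refine Finset.sum_congr rfl fun A _ => ?_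
  rw [setOf_bought_eq, thresholdMeasure_real_pi]
  congr 1
  refine Finset.prod_congr rfl fun i _ => ?_
  split_ifs
  · exact restrict_unit_real_Ico (h0 i) (h1 i)
  · rw [probReal_compl_eq_one_sub measurableSet_Ico, restrict_unit_real_Ico (h0 i) (h1 i)]

lemma thresholdMeasure_bought_inter_eq_empty {q : Fin m → ℝ} (h0 : 0 ≤ q) (h1 : q ≤ 1)
    (s : Finset (Fin m)) :
    (thresholdMeasure m).real {ω | bought q ω ∩ s = ∅} = ∏ i ∈ s, (1 - q i) := by
  have : {ω | bought q ω ∩ s = ∅}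
      = Set.univ.pi fun i => if i ∈ s then (Set.Ico 0 (q i))ᶜ else Set.univ := by
    ext ω
    simp only [Set.mem_ofPred_eq, Finset.eq_empty_iff_forall_notMem, Finset.mem_inter, mem_bought,
      Set.mem_univ_pi, not_and]
    refine forall_congr' fun i => ?_
    by_cases h : i ∈ s <;> simp [h]
  rw [this, thresholdMeasure_real_pi, ← Finset.prod_subset (Finset.subset_univ s)]
  · refine Finset.prod_congr rfl fun i hi => ?_
    rw [if_pos hi, probReal_compl_eq_one_sub measurableSet_Ico,
      restrict_unit_real_Ico (h0 i) (h1 i)]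
  · intro i _ hi
    rw [if_neg hi, probReal_univ]

/-- By independence the probabilities `exp (-(α * x i))` multiply to `exp (-α * ∑ x i)`; the
exponential form of `buyProb` is chosen for this. -/
lemma thresholdMeasure_uncovered_le {α : ℝ} (hα : 0 ≤ α) {x : Fin m → ℝ} (hx : 0 ≤ x)
    {s : Finset (Fin m)} (hs : 1 ≤ ∑ i ∈ s, x i) :
    (thresholdMeasure m).real {ω | bought (buyProb α x) ω ∩ s = ∅} ≤ Real.exp (-α) := by
  rw [thresholdMeasure_bought_inter_eq_empty (buyProb_nonneg hα hx) (buyProb_le_one α x)]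
  simp only [buyProb, sub_sub_cancel]
  rw [← Real.exp_sum, Finset.sum_neg_distrib, ← Finset.mul_sum]
  exact Real.exp_le_exp.2 (neg_le_neg (le_mul_of_one_le_right hα hs))

end Thresholds

/-! ### The randomized algorithm and its repairs -/

section Algorithm

variable {m : ℕ}

open Classical in
/-- A singleton consisting of a cheapest set that contains a given element. -/
noncomputable def cheapest (f : Finset (Fin m) → ℝ) (s : Finset (Fin m)) : Finset (Fin m) :=
  if h : s.Nonempty then {(s.exists_min_image (fun i => f {i}) h).choose} else ∅

lemma card_cheapest_le (f : Finset (Fin m) → ℝ) (s : Finset (Fin m)) :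
    (cheapest f s).card ≤ 1 := by
  unfold cheapest
  split_ifs <;> simp

lemma cheapest_inter_nonempty (f : Finset (Fin m) → ℝ) {s : Finset (Fin m)} (hs : s.Nonempty) :
    (cheapest f s ∩ s).Nonempty := by
  rw [cheapest, dif_pos hs]
  exact ⟨_, Finset.mem_inter.2 ⟨Finset.mem_singleton_self _,
    (s.exists_min_image (fun i => f {i}) hs).choose_spec.1⟩⟩

lemma le_of_mem_cheapest {f : Finset (Fin m) → ℝ} {s : Finset (Fin m)} {i j : Fin m}
    (hi : i ∈ cheapest f s) (hj : j ∈ s) : f {i} ≤ f {j} := by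
  have hs : s.Nonempty := ⟨j, hj⟩
  rw [cheapest, dif_pos hs, Finset.mem_singleton] at hi
  rw [hi]
  exact (s.exists_min_image (fun i => f {i}) hs).choose_spec.2 j hj

/-- The sets bought by the thresholds `ω` after the arrivals in `r`, latest arrival first. -/
noncomputable def boughtAfter (α : ℝ) (f : Finset (Fin m) → ℝ) (r : Input m) (ω : Fin m → ℝ) :
    Finset (Fin m) :=
  bought (buyProb α (fractionalSol α f r)) ω

/-- The sets added to cover elements that the thresholds leave uncovered on arrival. -/
noncomputable def repairs (α : ℝ) (f : Finset (Fin m) → ℝ) :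
    Input m → (Fin m → ℝ) → Finset (Fin m)
  | [], _ => ∅
  | s :: r, ω =>
    if boughtAfter α f (s :: r) ω ∩ s = ∅ then repairs α f r ω ∪ cheapest f s
    else repairs α f r ω

lemma repairs_subset_cons (α : ℝ) (f : Finset (Fin m) → ℝ) (s : Finset (Fin m)) (r : Input m)
    (ω : Fin m → ℝ) : repairs α f r ω ⊆ repairs α f (s :: r) ω := by
  rw [repairs]
  split_ifs
  · exact Finset.subset_union_left
  · exact subset_rfl

lemma boughtAfter_subset_cons {α : ℝ} (hα : 0 ≤ α) (f : Finset (Fin m) → ℝ) (s : Finset (Fin m))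
    (r : Input m) (ω : Fin m → ℝ) : boughtAfter α f r ω ⊆ boughtAfter α f (s :: r) ω :=
  bought_mono (buyProb_mono hα (le_fractionalStep s _)) ω

lemma measurableSet_repairs_eq (α : ℝ) (f : Finset (Fin m) → ℝ) (r : Input m)
    (A : Finset (Fin m)) : MeasurableSet {ω | repairs α f r ω = A} := by
  induction r generalizing A with
  | nil => by_cases h : ∅ = A <;> simp [repairs, h]
  | cons s r ih =>
    exact measurableSet_eq_comp₂ (measurableSet_bought_eq _) ih
      (fun a b => if a ∩ s = ∅ then b ∪ cheapest f s else b) A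

/-- Threshold rounding of the fractional solution, with repairs. -/
noncomputable def roundingDetAlgorithm {α : ℝ} (hα : 0 ≤ α) (f : Finset (Fin m) → ℝ)
    (ω : Fin m → ℝ) : DetAlgorithm m where
  active h := boughtAfter α f h.reverse ω ∪ repairs α f h.reverse ω
  active_nil := by
    have : buyProb α (fractionalSol α f ([] : Input m)) = 0 := by
      ext i; simp [buyProb, fractionalSol]
    rw [List.reverse_nil, boughtAfter, this, bought_zero, repairs, Finset.union_empty]
  active_mono h s := by
    rw [List.reverse_concat]
    exact Finset.union_subset_union (boughtAfter_subset_cons hα f s _ ω)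
      (repairs_subset_cons α f s _ ω)
  active_covers h s hs := by
    rw [List.reverse_concat]
    by_cases hcov : boughtAfter α f (s :: h.reverse) ω ∩ s = ∅
    · rw [repairs, if_pos hcov]
      exact (cheapest_inter_nonempty f hs).mono (Finset.inter_subset_inter_right
        (Finset.subset_union_right.trans Finset.subset_union_right))
    · exact (Finset.nonempty_iff_ne_empty.2 hcov).mono
        (Finset.inter_subset_inter_right Finset.subset_union_left)

/-- Threshold rounding with uniformly random thresholds. -/
noncomputable def roundingAlgorithm {α : ℝ} (hα : 0 ≤ α) (f : Finset (Fin m) → ℝ) :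
    RandAlgorithm m where
  Ω := Fin m → ℝ
  μ := thresholdMeasure m
  alg := roundingDetAlgorithm hα f
  measurableSet_active h A := measurableSet_eq_comp₂ (measurableSet_bought_eq _)
    (measurableSet_repairs_eq α f h.reverse) (fun a b => a ∪ b) A

lemma card_repairs_le_length (α : ℝ) (f : Finset (Fin m) → ℝ) (r : Input m) (ω : Fin m → ℝ) :
    (repairs α f r ω).card ≤ r.length := by
  induction r with
  | nil => simp [repairs]
  | cons s r ih =>
    rw [repairs, List.length_cons]
    split_ifs
    · exact (Finset.card_union_le _ _).trans (add_le_add ih (card_cheapest_le f s))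
    · omega

/-- A repair for `s` is no dearer than the member of `O` that meets `s`, hence no dearer than `O`.
-/
lemma cost_singleton_le_of_mem_repairs {α : ℝ} {f : Finset (Fin m) → ℝ} (hf : Monotone f)
    {O : Finset (Fin m)} {r : Input m} (hr : ∀ s ∈ r, (O ∩ s).Nonempty) {ω : Fin m → ℝ}
    {i : Fin m} (hi : i ∈ repairs α f r ω) : f {i} ≤ f O := by
  induction r with
  | nil => simp [repairs] at hi
  | cons s r ih =>
    have ih := ih fun t ht => hr t (List.mem_cons_of_mem _ ht)
    rw [repairs] at hi
    split_ifs at hi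
    · rcases Finset.mem_union.1 hi with hi | hi
      · exact ih hi
      · obtain ⟨j, hj⟩ := hr s List.mem_cons_self
        rw [Finset.mem_inter] at hj
        exact (le_of_mem_cheapest hi hj.2).trans (hf (Finset.singleton_subset_iff.2 hj.1))
    · exact ih hi

lemma integrable_boughtAfter (α : ℝ) (f : Finset (Fin m) → ℝ) (r : Input m)
    (Φ : Finset (Fin m) → ℝ) :
    Integrable (fun ω => Φ (boughtAfter α f r ω)) (thresholdMeasure m) :=
  integrable_comp_of_measurableSet_eq (measurableSet_bought_eq _) Φ

lemma integrable_repairs (α : ℝ) (f : Finset (Fin m) → ℝ) (r : Input m)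
    (Φ : Finset (Fin m) → ℝ) :
    Integrable (fun ω => Φ (repairs α f r ω)) (thresholdMeasure m) :=
  integrable_comp_of_measurableSet_eq (measurableSet_repairs_eq α f r) Φ

lemma integral_boughtAfter {α : ℝ} (hα : 0 ≤ α) (f : Finset (Fin m) → ℝ) (r : Input m)
    (Φ : Finset (Fin m) → ℝ) : ∫ ω, Φ (boughtAfter α f r ω) ∂(thresholdMeasure m)
      = setMean (buyProb α (fractionalSol α f r)) Φ :=
  integral_bought (buyProb_nonneg hα (fractionalSol_nonneg r)) (buyProb_le_one _ _) Φ

/-- Each arrival adds at most one repair, and only when the thresholds miss it, so expectations sum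
over the arrivals. -/
lemma integral_card_repairs_le {α : ℝ} (hα : 0 < α) {f : Finset (Fin m) → ℝ} (hf : Monotone f)
    (hf' : ∀ i, Monotone (marginal f i)) {r : Input m} (hr : ∀ s ∈ r, s.Nonempty) :
    ∫ ω, ((repairs α f r ω).card : ℝ) ∂(thresholdMeasure m) ≤ r.length * Real.exp (-α) := by
  induction r with
  | nil => simp [repairs]
  | cons s r ih =>
    have ih := ih fun t ht => hr t (List.mem_cons_of_mem _ ht)
    obtain ⟨-, hsum⟩ := fractionalSol_cons hα hf hf' (hr s List.mem_cons_self) r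
    have hP := thresholdMeasure_uncovered_le hα.le (fractionalSol_nonneg (α := α) (f := f)
      (s :: r)) hsum
    set U : Finset (Fin m) → ℝ := fun A => if A ∩ s = ∅ then 1 else 0 with hU
    have hle : ∀ ω, ((repairs α f (s :: r) ω).card : ℝ)
        ≤ (repairs α f r ω).card + U (boughtAfter α f (s :: r) ω) := fun ω => by
      rw [repairs, hU]
      dsimp only
      split_ifs
      · exact_mod_cast (Finset.card_union_le _ _).trans
          (Nat.add_le_add_left (card_cheapest_le f s) _)
      · simp
    have hUint : ∫ ω, U (boughtAfter α f (s :: r) ω) ∂(thresholdMeasure m) ≤ Real.exp (-α) := by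
      refine le_of_eq_of_le ?_ hP
      have hset : MeasurableSet {ω | bought (buyProb α (fractionalSol α f (s :: r))) ω ∩ s = ∅} :=
        measurableSet_eq_comp₂ (measurableSet_bought_eq _) (measurableSet_bought_eq 0)
          (fun a _ => a ∩ s) ∅
      rw [← integral_indicator_one hset]
      congr 1 with ω
      simp [hU, boughtAfter, Set.indicator_apply]
    have h1 := integral_mono (integrable_repairs α f (s :: r) fun A => (A.card : ℝ))
      ((integrable_repairs α f r fun A => (A.card : ℝ)).add
        (integrable_boughtAfter α f (s :: r) U)) hle
    simp only [Pi.add_apply] at h1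
    rw [integral_add (integrable_repairs α f r fun A => (A.card : ℝ))
      (integrable_boughtAfter α f (s :: r) U)] at h1
    rw [List.length_cons, Nat.cast_succ]
    linarith

lemma expectedCost_roundingAlgorithm {α : ℝ} (hα : 0 ≤ α) (f : Finset (Fin m) → ℝ)
    (F : (Fin m → ℝ) → ℝ) (c : Fin m → ℝ) (I : Input m) :
    (roundingAlgorithm hα f).expectedCost F c I
      = ∫ ω, cost F c (boughtAfter α f I.reverse ω ∪ repairs α f I.reverse ω)
          ∂(thresholdMeasure m) := rfl

lemma integrable_cost_active (α : ℝ) (f : Finset (Fin m) → ℝ) (F : (Fin m → ℝ) → ℝ)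
    (c : Fin m → ℝ) (r : Input m) :
    Integrable (fun ω => cost F c (boughtAfter α f r ω ∪ repairs α f r ω))
      (thresholdMeasure m) :=
  integrable_comp_of_measurableSet_eq (g := fun ω => boughtAfter α f r ω ∪ repairs α f r ω)
    (measurableSet_eq_comp₂ (measurableSet_bought_eq _) (measurableSet_repairs_eq α f r)
      (fun a b => a ∪ b)) _

lemma exists_isCover_cost_eq_opt (F : (Fin m → ℝ) → ℝ) (c : Fin m → ℝ) {I : Input m}
    (hI : I.Feasible) : ∃ O, IsCover I O ∧ cost F c O = opt F c I := by
  have hne : (cost F c '' {A | IsCover I A}).Nonempty :=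
    ⟨_, Finset.univ, fun s hs => by simpa using hI s hs, rfl⟩
  exact hne.csInf_mem (Set.toFinite _)

end Algorithm

/-! ### The bound for functions with power growth -/

variable {m : ℕ} {p : ℝ} {c : Fin m → ℝ}

/-- The cost vector of `A` is the average of the vectors `A.card • costVec c {i}`; apply convexity
and then scaling. -/
lemma HasPowerGrowth.cost_le_card_rpow {F : (Fin m → ℝ) → ℝ} (hF : HasPowerGrowth p F)
    (hc : ∀ i, 0 ≤ c i) {A : Finset (Fin m)} (hA : A.Nonempty) {T : ℝ}
    (hT : ∀ i ∈ A, cost F c {i} ≤ T) : cost F c A ≤ (A.card : ℝ) ^ p * T := by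
  have hcard : (1 : ℝ) ≤ A.card := by exact_mod_cast hA.card_pos
  have hcard0 : (0 : ℝ) < A.card := by linarith
  have h := hF.convex.map_sum_le (t := A) (w := fun _ => (A.card : ℝ)⁻¹)
    (p := fun i => (A.card : ℝ) • costVec c {i}) (fun _ _ => by positivity)
    (by rw [Finset.sum_const, nsmul_eq_mul, mul_inv_cancel₀ hcard0.ne'])
    (fun i _ => smul_nonneg hcard0.le (costVec_nonneg hc {i}))
  simp only [inv_smul_smul₀ hcard0.ne', smul_eq_mul, ← costVec_eq_sum] at h
  refine h.trans ?_
  have hterm : ∀ i ∈ A, (A.card : ℝ)⁻¹ * F ((A.card : ℝ) • costVec c {i})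
      ≤ (A.card : ℝ)⁻¹ * ((A.card : ℝ) ^ p * T) := fun i hi => by
    refine mul_le_mul_of_nonneg_left ?_ (inv_nonneg.2 hcard0.le)
    refine (hF.scale_le _ _ (costVec_nonneg hc {i}) hcard).trans ?_
    exact mul_le_mul_of_nonneg_left (hT i hi) (Real.rpow_nonneg hcard0.le p)
  refine (Finset.sum_le_sum hterm).trans_eq ?_
  rw [Finset.sum_const, nsmul_eq_mul, mul_inv_cancel_left₀ hcard0.ne']

lemma HasPowerGrowth.cost_union_le {F : (Fin m → ℝ) → ℝ} (hF : HasPowerGrowth p F)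
    (hc : ∀ i, 0 ≤ c i) (A B : Finset (Fin m)) :
    cost F c (A ∪ B) ≤ 2 ^ p * (cost F c A + cost F c B) := by
  have h1 := hF.monotone _ _ (costVec_nonneg hc (A ∪ B)) (costVec_union_le hc A B)
  have h2 := hF.add_le (costVec_nonneg hc A) (costVec_nonneg hc B)
    (θ := 1 / 2) (by norm_num) (by norm_num)
  have h3 : (1 / 2 : ℝ) ^ (1 - p) ≤ 2 ^ p := by
    rw [one_div, Real.inv_rpow zero_le_two, ← Real.rpow_neg zero_le_two]
    exact Real.rpow_le_rpow_of_exponent_le one_le_two (by linarith)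
  rw [show (1 : ℝ) - 1 / 2 = 1 / 2 by norm_num, ← mul_add] at h2
  refine (h1.trans h2).trans (mul_le_mul_of_nonneg_right h3 ?_)
  exact add_nonneg (hF.cost_nonneg hc A) (hF.cost_nonneg hc B)

lemma natCast_rpow_mul_exp_le_one (n : ℕ) {q : ℝ} (hq : 0 < q) :
    (n : ℝ) ^ q * Real.exp (-(q * tlog n)) ≤ 1 := by
  rcases Nat.eq_zero_or_pos n with rfl | hn
  · rw [Nat.cast_zero, Real.zero_rpow hq.ne', zero_mul]
    exact zero_le_one
  · have hn' : (0 : ℝ) < n := by exact_mod_cast hn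
    rw [Real.rpow_def_of_pos hn', ← Real.exp_add]
    refine Real.exp_le_one_iff.2 ?_
    have : Real.log n ≤ tlog n := le_max_right _ _
    nlinarith

/-- The expected number of repairs is small enough to pay for the worst case `n ^ (p - 1)`. -/
lemma natCast_rpow_mul_integral_card_repairs_le (n : ℕ) (hp : 1 ≤ p)
    {f : Finset (Fin m) → ℝ} (hf : Monotone f) (hf' : ∀ i, Monotone (marginal f i)) {r : Input m}
    (hr : ∀ s ∈ r, s.Nonempty) (hn : r.length = n) :
    (n : ℝ) ^ (p - 1) * ∫ ω, ((repairs (p * tlog n) f r ω).card : ℝ) ∂(thresholdMeasure m)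
      ≤ 1 := by
  have hα : 0 < p * tlog n := mul_pos (by linarith) (by linarith [one_le_tlog n])
  have h := integral_card_repairs_le hα hf hf' hr
  rw [hn] at h
  refine (mul_le_mul_of_nonneg_left h (Real.rpow_nonneg n.cast_nonneg _)).trans
    (le_trans (le_of_eq ?_) (natCast_rpow_mul_exp_le_one n (by linarith : 0 < p)))
  rcases Nat.eq_zero_or_pos n with rfl | hn0
  · rw [Nat.cast_zero, Real.zero_rpow (by linarith : p ≠ 0)]
    ring
  · have hn' : (n : ℝ) ≠ 0 := by exact_mod_cast hn0.ne'
    rw [← mul_assoc, Real.rpow_sub_one hn', div_mul_cancel₀ _ hn']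

/-- The choice `α = p * tlog n` makes repairs so rare that their worst-case price `n ^ (p - 1)`
apiece, relative to the optimum, is at most 1 in expectation. -/
lemma HasPowerGrowth.exists_isCompetitive {F : (Fin m → ℝ) → ℝ} (hF : HasPowerGrowth p F)
    (hc : ∀ i, 0 ≤ c i) (n : ℕ) : ∃ R : RandAlgorithm m,
      R.IsCompetitive n F c ((384 * (p ^ 2 * tlog m * tlog n)) ^ p) := by
  have hp := hF.one_le
  have hα1 : 1 ≤ p * tlog n := one_le_mul_of_one_le_of_one_le hp (one_le_tlog n)
  have hα0 : 0 ≤ p * tlog n := by linarith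
  refine ⟨roundingAlgorithm hα0 (cost F c), fun I hn hI => ?_⟩
  obtain ⟨O, hO, hopt⟩ := exists_isCover_cost_eq_opt F c hI
  rw [expectedCost_roundingAlgorithm, ← hopt]
  have hr : ∀ s ∈ I.reverse, (O ∩ s).Nonempty := fun s hs => hO s (List.mem_reverse.1 hs)
  have hne : ∀ s ∈ I.reverse, s.Nonempty := fun s hs => hI s (List.mem_reverse.1 hs)
  have hlen : I.reverse.length = n := by rw [List.length_reverse, hn]
  generalize I.reverse = r at hr hne hlen
  set α := p * tlog n with hαdef
  set f := cost F c with hfdef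
  have hmono : Monotone f := hF.cost_mono hc
  have hfO : 0 ≤ f O := hF.cost_nonneg hc O
  have hround := hF.roundedCost_fractionalSol_le hc hα1 r hr
  have hcard := natCast_rpow_mul_integral_card_repairs_le n hp hmono (hF.marginal_mono hc) hne hlen
  have hrep : ∀ ω, f (repairs α f r ω)
      ≤ f O + ((n : ℝ) ^ (p - 1) * (repairs α f r ω).card) * f O := fun ω => by
    rcases (repairs α f r ω).eq_empty_or_nonempty with he | he
    · rw [he]
      simpa using hmono (Finset.empty_subset O)
    · have h1 := hF.cost_le_card_rpow hc he
        (fun i hi => cost_singleton_le_of_mem_repairs hmono hr hi)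
      have hk : (0 : ℝ) < (repairs α f r ω).card := by exact_mod_cast he.card_pos
      have hkn : ((repairs α f r ω).card : ℝ) ≤ n := by
        rw [← hlen]; exact_mod_cast card_repairs_le_length α f r ω
      -- At most `n` repairs occur, so the `p`-th power is linear in their number up to `n ^ (p -
      -- 1)`; only a first moment is needed.
      have h2 : ((repairs α f r ω).card : ℝ) ^ p
          ≤ (n : ℝ) ^ (p - 1) * (repairs α f r ω).card := by
        rw [← div_le_iff₀ hk, ← Real.rpow_sub_one hk.ne']
        exact Real.rpow_le_rpow hk.le hkn (by linarith)
      linarith [mul_le_mul_of_nonneg_right h2 hfO]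
  have hI1 := integrable_boughtAfter α f r f
  have hI2 := integrable_repairs α f r fun A => (A.card : ℝ)
  have hI3 : Integrable (fun ω => f O + ((n : ℝ) ^ (p - 1) * (repairs α f r ω).card) * f O)
      (thresholdMeasure m) :=
    (integrable_const (f O)).add ((hI2.const_mul _).mul_const _)
  have hmain : ∫ ω, f (boughtAfter α f r ω ∪ repairs α f r ω) ∂(thresholdMeasure m)
      ≤ ∫ ω, 2 ^ p * (f (boughtAfter α f r ω)
        + (f O + ((n : ℝ) ^ (p - 1) * (repairs α f r ω).card) * f O)) ∂(thresholdMeasure m) := by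
    refine integral_mono (integrable_cost_active α f F c r) ((hI1.add hI3).const_mul _)
      fun ω => (hF.cost_union_le hc _ _).trans ?_
    exact mul_le_mul_of_nonneg_left (add_le_add_right (hrep ω) _) (by positivity)
  rw [integral_const_mul, integral_add hI1 hI3, integral_add (integrable_const _)
    ((hI2.const_mul _).mul_const _), integral_mul_const, integral_const_mul,
    integral_boughtAfter hα0, integral_const, probReal_univ, one_smul] at hmain
  refine hmain.trans ?_
  have hT := one_le_tlog (m : ℝ)
  set K := 32 * (p * α * tlog m) with hK
  have hK1 : 1 ≤ K := by
    have := one_le_mul_of_one_le_of_one_le (one_le_mul_of_one_le_of_one_le hp hα1) hT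
    rw [hK]; linarith
  have hKp : 1 ≤ K ^ p := Real.one_le_rpow hK1 (by linarith)
  have h6 : (6 : ℝ) ≤ 6 ^ p := by
    simpa using Real.rpow_le_rpow_of_exponent_le (by norm_num : (1 : ℝ) ≤ 6) hp
  -- `384 = 2 * 6 * 32`: 2 from the union bound, 6 from the rounded cost `4 * K ^ p` plus two terms
  -- for repairs, 32 from `K`.
  have hratio : (384 * (p ^ 2 * tlog m * tlog n)) ^ p = 2 ^ p * (6 ^ p * K ^ p) := by
    rw [← Real.mul_rpow (by norm_num) (by linarith), ← Real.mul_rpow (by norm_num) (by linarith),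
      hK, hαdef]
    congr 1
    ring
  rw [hratio, mul_assoc (2 ^ p)]
  refine mul_le_mul_of_nonneg_left ?_ (Real.rpow_nonneg zero_le_two p)
  have h1 : (n : ℝ) ^ (p - 1) * (∫ ω, ((repairs α f r ω).card : ℝ) ∂(thresholdMeasure m)) * f O
      ≤ 1 * f O := mul_le_mul_of_nonneg_right hcard hfO
  have h2 : f O ≤ K ^ p * f O := le_mul_of_one_le_left hfO hKp
  have h3 : 6 * (K ^ p * f O) ≤ 6 ^ p * (K ^ p * f O) :=
    mul_le_mul_of_nonneg_right h6 (mul_nonneg (by linarith) hfO)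
  rw [roundedCost] at hround
  linarith

/-! ### The bound for the norm of linear functions -/

section Norm

variable {d : ℕ} {B : Fin d → Fin m → ℝ}

lemma lpNormOfLinear_nonneg (p : ℝ) (B : Fin d → Fin m → ℝ) (y : Fin m → ℝ) :
    0 ≤ lpNormOfLinear p B y :=
  Real.rpow_nonneg (Finset.sum_nonneg fun _ _ => Real.rpow_nonneg (abs_nonneg _) _) _

lemma lpNormOfLinear_add_le (hp : 1 ≤ p) (B : Fin d → Fin m → ℝ) (y z : Fin m → ℝ) :
    lpNormOfLinear p B (y + z) ≤ lpNormOfLinear p B y + lpNormOfLinear p B z := by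
  simpa only [lpNormOfLinear, Pi.add_apply, mul_add, Finset.sum_add_distrib] using
    Real.Lp_add_le Finset.univ (fun k => ∑ i, B k i * y i) (fun k => ∑ i, B k i * z i) hp

lemma lpNormOfLinear_mono (hp : 1 ≤ p) (hB : ∀ k i, 0 ≤ B k i) {y z : Fin m → ℝ} (hy : 0 ≤ y)
    (hyz : y ≤ z) : lpNormOfLinear p B y ≤ lpNormOfLinear p B z :=
  Real.rpow_le_rpow ((hasPowerGrowth_sum_rpow hp hB).nonneg y hy)
    ((hasPowerGrowth_sum_rpow hp hB).monotone y z hy hyz) (by positivity)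

/-- Subadditivity of the norm charges every repair separately, without the `p`-th power of their
number. -/
lemma cost_lpNormOfLinear_union_le (hp : 1 ≤ p) (hB : ∀ k i, 0 ≤ B k i) (hc : ∀ i, 0 ≤ c i)
    (A A' : Finset (Fin m)) : cost (lpNormOfLinear p B) c (A ∪ A')
      ≤ cost (lpNormOfLinear p B) c A + ∑ i ∈ A', cost (lpNormOfLinear p B) c {i} := by
  induction A' using Finset.induction_on with
  | empty => simp
  | insert i A' hi ih =>
    rw [Finset.sum_insert hi, Finset.union_insert, Finset.insert_eq, Finset.union_comm]
    have h1 := lpNormOfLinear_mono hp hB (costVec_nonneg hc (A ∪ A' ∪ {i}))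
      (costVec_union_le hc (A ∪ A') {i})
    have h2 := lpNormOfLinear_add_le hp B (costVec c (A ∪ A')) (costVec c {i})
    simp only [cost_eq] at ih ⊢
    linarith

/-- Jensen's inequality for the `p`-th root. -/
lemma setMean_le_rpow (hp : 1 ≤ p) {q : Fin m → ℝ} (h0 : 0 ≤ q) (h1 : q ≤ 1)
    {f : Finset (Fin m) → ℝ} (hf : ∀ A, 0 ≤ f A) :
    setMean q (fun A => f A ^ (1 / p)) ≤ setMean q f ^ (1 / p) := by
  have hp0 : 0 < p := by linarith
  have h := Real.arith_mean_le_rpow_mean Finset.univ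
    (fun A : Finset (Fin m) => ∏ i, if i ∈ A then q i else 1 - q i) (fun A => f A ^ (1 / p))
    (fun A _ => setWeight_nonneg h0 h1 A) (sum_setWeight q)
    (fun A _ => Real.rpow_nonneg (hf A) _) hp
  simpa only [setMean, ← Real.rpow_mul (hf _), one_div_mul_cancel hp0.ne', Real.rpow_one] using h

lemma exists_isCompetitive_lpNormOfLinear (hp : 1 ≤ p) (hB : ∀ k i, 0 ≤ B k i)
    (hc : ∀ i, 0 ≤ c i) (n : ℕ) : ∃ R : RandAlgorithm m,
      R.IsCompetitive n (lpNormOfLinear p B) c (129 * (p * tlog m * tlog n)) := by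
  have hp0 : 0 < p := by linarith
  -- The repair bound is used with exponent 1, hence the form `1 * tlog n`. A smaller `α` saves a
  -- factor `p` in the ratio.
  have hα1 : 1 ≤ 1 * tlog n := by rw [one_mul]; exact one_le_tlog n
  have hα0 : 0 ≤ 1 * tlog n := by linarith
  have hF := hasPowerGrowth_sum_rpow hp hB
  set F : (Fin m → ℝ) → ℝ := fun y => ∑ k, |∑ i, B k i * y i| ^ p with hFdef
  refine ⟨roundingAlgorithm hα0 (cost F c), fun I hn hI => ?_⟩
  obtain ⟨O, hO, hopt⟩ := exists_isCover_cost_eq_opt (lpNormOfLinear p B) c hI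
  rw [expectedCost_roundingAlgorithm, ← hopt]
  have hr : ∀ s ∈ I.reverse, (O ∩ s).Nonempty := fun s hs => hO s (List.mem_reverse.1 hs)
  have hne : ∀ s ∈ I.reverse, s.Nonempty := fun s hs => hI s (List.mem_reverse.1 hs)
  have hlen : I.reverse.length = n := by rw [List.length_reverse, hn]
  generalize I.reverse = r at hr hne hlen
  set α := 1 * tlog n with hαdef
  set f := cost F c with hfdef
  set N := cost (lpNormOfLinear p B) c with hNdef
  have hN : ∀ A, N A = f A ^ (1 / p) := fun A => rfl
  have hmono : Monotone f := hF.cost_mono hc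
  have hfO : 0 ≤ f O := hF.cost_nonneg hc O
  have hNO : 0 ≤ N O := lpNormOfLinear_nonneg p B _
  have hround := hF.roundedCost_fractionalSol_le hc hα1 r hr
  have hcard := natCast_rpow_mul_integral_card_repairs_le n le_rfl hmono (hF.marginal_mono hc)
    hne hlen
  rw [sub_self, Real.rpow_zero, one_mul] at hcard
  have hI1 := integrable_boughtAfter α f r N
  have hI2 := integrable_repairs α f r fun A => (A.card : ℝ)
  have hmain : ∫ ω, N (boughtAfter α f r ω ∪ repairs α f r ω) ∂(thresholdMeasure m)
      ≤ ∫ ω, (N (boughtAfter α f r ω) + (repairs α f r ω).card * N O) ∂(thresholdMeasure m) := by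
    refine integral_mono (integrable_cost_active α f _ c r) (hI1.add (hI2.mul_const _))
      fun ω => (cost_lpNormOfLinear_union_le hp hB hc _ _).trans ?_
    refine add_le_add_right ?_ _
    rw [← nsmul_eq_mul, ← Finset.sum_const]
    refine Finset.sum_le_sum fun i hi => ?_
    exact Real.rpow_le_rpow (hF.cost_nonneg hc {i})
      (cost_singleton_le_of_mem_repairs hmono hr hi) (by positivity)
  rw [integral_add hI1 (hI2.mul_const _), integral_mul_const, integral_boughtAfter hα0] at hmain
  refine hmain.trans ?_
  have hx : 0 ≤ fractionalSol α f r := fractionalSol_nonneg r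
  have hJ : setMean (buyProb α (fractionalSol α f r)) N
      ≤ roundedCost α f (fractionalSol α f r) ^ (1 / p) :=
    setMean_le_rpow hp (buyProb_nonneg hα0 hx) (buyProb_le_one _ _) (hF.cost_nonneg hc)
  have hT := one_le_tlog (m : ℝ)
  have hpαT : 1 ≤ p * α * tlog m := one_le_mul_of_one_le_of_one_le
    (one_le_mul_of_one_le_of_one_le hp hα1) hT
  set K := 32 * (p * α * tlog m) with hK
  have hK0 : 0 ≤ K := by rw [hK]; linarith
  have h4 : (4 : ℝ) ≤ 4 ^ p := by
    simpa using Real.rpow_le_rpow_of_exponent_le (by norm_num : (1 : ℝ) ≤ 4) hp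
  have hroot : roundedCost α f (fractionalSol α f r) ^ (1 / p) ≤ 4 * K * N O := by
    have h1 : roundedCost α f (fractionalSol α f r) ≤ (4 * K * N O) ^ p := by
      rw [Real.mul_rpow (by positivity) hNO, Real.mul_rpow (by norm_num) hK0, hN,
        ← Real.rpow_mul hfO, one_div_mul_cancel hp0.ne', Real.rpow_one]
      exact hround.trans (mul_le_mul_of_nonneg_right
        (mul_le_mul_of_nonneg_right h4 (Real.rpow_nonneg hK0 p)) hfO)
    have h2 := Real.rpow_le_rpow (setMean_nonneg (buyProb_nonneg hα0 hx) (buyProb_le_one _ _)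
      (hF.cost_nonneg hc)) h1 (by positivity : 0 ≤ 1 / p)
    rwa [← Real.rpow_mul (by positivity), mul_one_div_cancel hp0.ne', Real.rpow_one] at h2
  have hB1 := mul_le_mul_of_nonneg_right hcard hNO
  have hB2 : 1 * N O ≤ p * α * tlog m * N O := mul_le_mul_of_nonneg_right hpαT hNO
  -- `129 = 4 * 32 + 1`: the rounding contributes `4 * K`, and the repairs cost at most one further
  -- `N O` in expectation.
  have hfinal : 129 * (p * tlog m * tlog n) * N O = 4 * K * N O + p * α * tlog m * N O := by
    rw [hK, hαdef]; ring
  rw [hfinal]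
  linarith

end Norm

end OnlineSetCover

theorem theorem2 :
    (∃ C : ℝ, 0 < C ∧
      ∀ (m n : ℕ) (p : ℝ) (f : (Fin m → ℝ) → ℝ) (c : Fin m → ℝ),
        OnlineSetCover.IsPBounded p f → (∀ i, 0 ≤ c i) →
        ∃ R : OnlineSetCover.RandAlgorithm m,
          R.IsCompetitive n f c
            ((C * (p ^ 2 * OnlineSetCover.tlog m * OnlineSetCover.tlog n *
              OnlineSetCover.tlog (Real.log n))) ^ p)) ∧
    (∃ C : ℝ, 0 < C ∧
      ∀ (m n d : ℕ) (p : ℝ) (B : Fin d → Fin m → ℝ) (c : Fin m → ℝ),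
        1 ≤ p → (∀ k i, 0 ≤ B k i) → (∀ i, 0 ≤ c i) →
        ∃ R : OnlineSetCover.RandAlgorithm m,
          R.IsCompetitive n (OnlineSetCover.lpNormOfLinear p B) c
            (C * (p * OnlineSetCover.tlog m * OnlineSetCover.tlog n))) := by
  refine ⟨⟨384, by norm_num, fun m n p f c hf hc => ?_⟩, ⟨129, by norm_num,
    fun m n d p B c hp hB hc => OnlineSetCover.exists_isCompetitive_lpNormOfLinear hp hB hc n⟩⟩
  obtain ⟨R, hR⟩ := hf.hasPowerGrowth.exists_isCompetitive hc n
  -- The additional factor `tlog (log n) ≥ 1` only weakens the bound, since the optimum is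
  -- nonnegative.
  refine ⟨R, fun I hn hI => (hR I hn hI).trans (mul_le_mul_of_nonneg_right ?_ ?_)⟩
  · have hp := hf.one_le
    have hm := OnlineSetCover.one_le_tlog (m : ℝ)
    have hn := OnlineSetCover.one_le_tlog (n : ℝ)
    refine Real.rpow_le_rpow (by positivity) ?_ (by linarith)
    exact mul_le_mul_of_nonneg_left
      (le_mul_of_one_le_right (by positivity) (OnlineSetCover.one_le_tlog _)) (by norm_num)
  · obtain ⟨O, -, hO⟩ := OnlineSetCover.exists_isCover_cost_eq_opt f c hI
    rw [← hO]
    exact hf.hasPowerGrowth.cost_nonneg hc O
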